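/- Let $r\ge 0$, let $G=S^1\times SU_{r+1}$, let $q$ and $\Lambda=(\Lambda_0,\dots,\Lambda_r\mid \Lambda_0\cdots\Lambda_r=1)$ be the multiplicative coordinates on $S^1$ and on the maximal torus $T^r$ of $SU_{r+1}$, and let $\mathbb Q(\Lambda,q)$ be the field of fractions of the representation ring of $S^1\times T^r$. Let $X$ be the manifold of complete flags $0\subset E^1\subset\dots\subset E^r\subset\mathbb C^{r+1}$, on which $G$ acts through $SU_{r+1}$, let $p_i=\Lambda^iE^i$ ($i=1,\dots,r$) be the pull-backs of the Hopf line bundles under the Plücker maps, and put $K:=K_G^*(X)\otimes_{K_G(pt)}\mathbb Q(\Lambda,q)$. Consider formal series $I=p^{\ln Q/\ln q}\sum_{d\ge 0}I_dQ^d$ with $I_d\in K$, where $Q^d=Q_1^{d_1}\cdots Q_r^{d_r}$, $Q_i=e^{t_{i-1}-t_i}$ and $p^{\ln Q/\ln q}=\prod_i p_i^{\ln Q_i/\ln q}$. For $m\in\mathbb Z^{r+1}$ let $q^{m\cdot\partial/\partial t}$ be the translation $t_j\mapsto t_j+m_j\ln q$; on such series it acts $K$-linearly, multiplying $p^{\ln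 Q/\ln q}Q^d$ by $\prod_{i=1}^r(p_iq^{d_i})^{m_{i-1}-m_i}$. Let $$\hat H=q^{\partial/\partial t_0}+q^{\partial/\partial t_1}(1-e^{t_0-t_1})+\dots+q^{\partial/\partial t_r}(1-e^{t_{r-1}-t_r})$$ be the finite-difference Toda operator, and let $\hat D=\sum_m c_m(Q)\,q^{m\cdot\partial/\partial t}$ (a finite sum) be a finite-difference operator whose coefficients $c_m\in K[Q_1,\dots,Q_r]$ are polynomial in $Q$ and which commutes with $\hat H$ (as operators on these series). **Lemma (finite-difference Kim's lemma).** Let $I$ be such a series with $I_0\neq 0$. If $\hat HI=\Lambda_HI$ for some scalar $\Lambda_H\in\mathbb Q(\Lambda,q)$, and $\hat DI\equiv\Lambda_DI$ modulo the ideal $(Q_1,\dots,Q_r)$ for some $\Lambda_D\in K$ (for instance a scalar $\Lambda_D\in\mathbb Q(\Lambda,q)$), then $\hat DI=\Lambda_DI$. -/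

import Mathlib

namespace QToda

/-! ### Equivariant K-theory

A `G`-equivariant complex vector bundle on a compact `G`-space `X` is a direct summand of a trivial
bundle `X × V` with `V` a finite-dimensional representation of `G`.  It is recorded here by the
representation `V` (with a chosen basis) and the continuous equivariant family of projections of `V`
onto the fibres.  `EqBundle G X ι` is the type of such data with `V = ℂ^ι`. -/

section Bundles

/-- A `G`-equivariant complex vector bundle on `X`, as the image of a continuous equivariant family
`proj` of idempotents in the trivial bundle with fibre the continuous representation `rep`. -/
structure EqBundle (G : Type) [Group G] [TopologicalSpace G]
    (X : Type) [TopologicalSpace X] [MulAction G X]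
    (ι : Type) [Fintype ι] [DecidableEq ι] where
  rep : G →* Matrix ι ι ℂ
  continuous_rep : Continuous rep
  proj : X → Matrix ι ι ℂ
  continuous_proj : Continuous proj
  idem : ∀ x, proj x * proj x = proj x
  equivariant : ∀ g x, proj (g • x) * rep g = rep g * proj x

variable {G : Type} [Group G] [TopologicalSpace G]
variable {X : Type} [TopologicalSpace X] [MulAction G X]
variable {ι κ : Type} [Fintype ι] [DecidableEq ι] [Fintype κ] [DecidableEq κ]

namespace EqBundle

/-- Isomorphism of equivariant bundles: continuous equivariant families of linear maps `u`, `v`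
in both directions which induce mutually inverse maps between the images of the projections. -/
def Iso (E : EqBundle G X ι) (F : EqBundle G X κ) : Prop :=
  ∃ (u : X → Matrix κ ι ℂ) (v : X → Matrix ι κ ℂ),
    Continuous u ∧ Continuous v ∧
    (∀ g x, u (g • x) * E.rep g = F.rep g * u x) ∧
    (∀ g x, v (g • x) * F.rep g = E.rep g * v x) ∧
    (∀ x, v x * u x = E.proj x) ∧ (∀ x, u x * v x = F.proj x)

/-- Change of the index set of the basis. -/
noncomputable def reindex (e : ι ≃ κ) (E : EqBundle G X ι) : EqBundle G X κ where
  rep := (Matrix.reindexAlgEquiv ℂ ℂ e).toAlgHom.toMonoidHom.comp E.rep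
  continuous_rep := E.continuous_rep.matrix_submatrix e.symm e.symm
  proj x := Matrix.reindexAlgEquiv ℂ ℂ e (E.proj x)
  continuous_proj := E.continuous_proj.matrix_submatrix e.symm e.symm
  idem x := by rw [← map_mul, E.idem]
  equivariant g x := by
    change Matrix.reindexAlgEquiv ℂ ℂ e (E.proj (g • x)) * Matrix.reindexAlgEquiv ℂ ℂ e (E.rep g)
      = Matrix.reindexAlgEquiv ℂ ℂ e (E.rep g) * Matrix.reindexAlgEquiv ℂ ℂ e (E.proj x)
    rw [← map_mul, ← map_mul, E.equivariant]

/-- Direct sum. -/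
noncomputable def directSum (E : EqBundle G X ι) (F : EqBundle G X κ) : EqBundle G X (ι ⊕ κ) where
  rep :=
    { toFun := fun g => Matrix.fromBlocks (E.rep g) 0 0 (F.rep g)
      map_one' := by simp
      map_mul' := fun g h => by simp [Matrix.fromBlocks_multiply] }
  continuous_rep :=
    E.continuous_rep.matrix_fromBlocks continuous_const continuous_const F.continuous_rep
  proj x := Matrix.fromBlocks (E.proj x) 0 0 (F.proj x)
  continuous_proj :=
    E.continuous_proj.matrix_fromBlocks continuous_const continuous_const F.continuous_proj
  idem x := by simp [Matrix.fromBlocks_multiply, E.idem, F.idem]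
  equivariant g x := by
    simp [Matrix.fromBlocks_multiply, E.equivariant, F.equivariant]

/-- Tensor product. -/
noncomputable def tensor (E : EqBundle G X ι) (F : EqBundle G X κ) : EqBundle G X (ι × κ) where
  rep :=
    { toFun := fun g => Matrix.kronecker (E.rep g) (F.rep g)
      map_one' := by simp [Matrix.kronecker]
      map_mul' := fun g h => by
        simp only [map_mul]
        exact Matrix.mul_kronecker_mul _ _ _ _ }
  continuous_rep := continuous_matrix fun i j =>
    (E.continuous_rep.matrix_elem i.1 j.1).mul (F.continuous_rep.matrix_elem i.2 j.2)
  proj x := Matrix.kronecker (E.proj x) (F.proj x)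
  continuous_proj := continuous_matrix fun i j =>
    (E.continuous_proj.matrix_elem i.1 j.1).mul (F.continuous_proj.matrix_elem i.2 j.2)
  idem x := by
    refine (Matrix.mul_kronecker_mul _ _ _ _).symm.trans ?_
    rw [E.idem, F.idem]
    rfl
  equivariant g x := by
    refine (Matrix.mul_kronecker_mul _ _ _ _).symm.trans ?_
    rw [E.equivariant, F.equivariant]
    exact Matrix.mul_kronecker_mul _ _ _ _

/-- Dual bundle: the contragredient representation and the transposed projections. -/
noncomputable def dual [ContinuousInv G] (E : EqBundle G X ι) : EqBundle G X ι where
  rep :=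
    { toFun := fun g => (E.rep g⁻¹).transpose
      map_one' := by simp
      map_mul' := fun g h => by simp [Matrix.transpose_mul] }
  continuous_rep := (E.continuous_rep.comp continuous_inv).matrix_transpose
  proj x := (E.proj x).transpose
  continuous_proj := E.continuous_proj.matrix_transpose
  idem x := by rw [← Matrix.transpose_mul, E.idem]
  equivariant g x := by
    have h := E.equivariant g⁻¹ (g • x)
    rw [inv_smul_smul] at h
    change (E.proj (g • x)).transpose * (E.rep g⁻¹).transpose
      = (E.rep g⁻¹).transpose * (E.proj x).transpose
    rw [← Matrix.transpose_mul, ← Matrix.transpose_mul, h]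

variable (G X) in
/-- The trivial line bundle with the trivial action on the fibre. -/
noncomputable def trivialLine : EqBundle G X (Fin 1) where
  rep := 1
  continuous_rep := continuous_const
  proj _ := 1
  continuous_proj := continuous_const
  idem _ := by simp
  equivariant _ _ := by simp

/-- Pull-back along a map `f : X → Y` which is equivariant along a homomorphism `φ : H → G`. -/
noncomputable def pull {H : Type} [Group H] [TopologicalSpace H] {Y : Type} [TopologicalSpace Y] [MulAction H Y]
    (φ : H →* G) (hφ : Continuous φ) (f : Y → X) (hf : Continuous f)
    (hfe : ∀ h y, f (h • y) = φ h • f y) (E : EqBundle G X ι) : EqBundle H Y ι where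
  rep := E.rep.comp φ
  continuous_rep := E.continuous_rep.comp hφ
  proj y := E.proj (f y)
  continuous_proj := E.continuous_proj.comp hf
  idem y := E.idem _
  equivariant h y := by
    rw [hfe]
    exact E.equivariant _ _

end EqBundle

variable (G X) in
/-- Polynomial ring on the equivariant bundles over `X`. -/
abbrev FreeBundleRing : Type := MvPolynomial (Σ n : ℕ, EqBundle G X (Fin n)) ℤ

/-- The variable attached to a bundle. -/
noncomputable def gen {n : ℕ} (E : EqBundle G X (Fin n)) : FreeBundleRing G X := MvPolynomial.X ⟨n, E⟩

variable (G X) in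
/-- Defining relations of the Grothendieck ring. -/
inductive KRel : FreeBundleRing G X → FreeBundleRing G X → Prop
  | iso {m n : ℕ} (E : EqBundle G X (Fin m)) (F : EqBundle G X (Fin n)) (h : E.Iso F) :
      KRel (gen E) (gen F)
  | add {m n : ℕ} (E : EqBundle G X (Fin m)) (F : EqBundle G X (Fin n)) :
      KRel (gen ((E.directSum F).reindex finSumFinEquiv)) (gen E + gen F)
  | mul {m n : ℕ} (E : EqBundle G X (Fin m)) (F : EqBundle G X (Fin n)) :
      KRel (gen ((E.tensor F).reindex finProdFinEquiv)) (gen E * gen F)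
  | one : KRel (gen (EqBundle.trivialLine G X)) 1

variable (G X) in
/-- The ideal generated by the relations. -/
noncomputable def kIdeal : Ideal (FreeBundleRing G X) :=
  Ideal.span {x | ∃ a b, KRel G X a b ∧ x = a - b}

variable (G X) in
/-- The equivariant K-ring `K_G(X)`: the Grothendieck ring of `G`-equivariant complex vector bundles
over `X`, with sum and product induced by `⊕` and `⊗`. -/
def KRing : Type := FreeBundleRing G X ⧸ kIdeal G X

noncomputable instance : CommRing (KRing G X) :=
  inferInstanceAs (CommRing (FreeBundleRing G X ⧸ kIdeal G X))

variable (G X) in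
/-- The quotient homomorphism from the polynomial ring on the equivariant bundles. -/
noncomputable def kMk : FreeBundleRing G X →+* KRing G X := Ideal.Quotient.mk (kIdeal G X)

/-- The class of a bundle in the K-ring. -/
noncomputable def cls {n : ℕ} (E : EqBundle G X (Fin n)) : KRing G X := kMk G X (gen E)

theorem mk_eq_of_rel {a b : FreeBundleRing G X} (h : KRel G X a b) :
    kMk G X a = kMk G X b :=
  Ideal.Quotient.eq.2 (Ideal.subset_span ⟨a, b, h, rfl⟩)

/-- The ring homomorphism `K_G(X) → K_H(Y)` given by pull-back of bundles. -/
noncomputable def kPull {H : Type} [Group H] [TopologicalSpace H] {Y : Type} [TopologicalSpace Y] [MulAction H Y]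
    (φ : H →* G) (hφ : Continuous φ) (f : Y → X) (hf : Continuous f)
    (hfe : ∀ h y, f (h • y) = φ h • f y) : KRing G X →+* KRing H Y :=
  Ideal.Quotient.lift (kIdeal G X)
    (MvPolynomial.eval₂Hom (Int.castRingHom (KRing H Y))
      (fun E => cls (E.2.pull φ hφ f hf hfe))) (by
    intro a ha
    refine (Ideal.span_le.2 ?_ : kIdeal G X ≤ RingHom.ker _) ha
    rintro _ ⟨a, b, h, rfl⟩
    change MvPolynomial.eval₂Hom _ _ (a - b) = 0
    rw [map_sub, sub_eq_zero]
    cases h with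
    | iso E F h =>
      simp only [gen, MvPolynomial.coe_eval₂Hom, MvPolynomial.eval₂_X]
      refine mk_eq_of_rel (.iso _ _ ?_)
      obtain ⟨u, v, hu, hv, h1, h2, h3, h4⟩ := h
      refine ⟨u ∘ f, v ∘ f, hu.comp hf, hv.comp hf, fun g y => ?_, fun g y => ?_,
        fun y => h3 _, fun y => h4 _⟩
      · simp only [Function.comp_apply, hfe]
        exact h1 _ _
      · simp only [Function.comp_apply, hfe]
        exact h2 _ _
    | add E F =>
      simp only [gen, map_add, MvPolynomial.coe_eval₂Hom, MvPolynomial.eval₂_X]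
      exact mk_eq_of_rel (.add (E.pull φ hφ f hf hfe) (F.pull φ hφ f hf hfe))
    | mul E F =>
      simp only [gen, map_mul, MvPolynomial.coe_eval₂Hom, MvPolynomial.eval₂_X]
      exact mk_eq_of_rel (.mul (E.pull φ hφ f hf hfe) (F.pull φ hφ f hf hfe))
    | one =>
      simp only [gen, map_one, MvPolynomial.coe_eval₂Hom, MvPolynomial.eval₂_X]
      exact mk_eq_of_rel .one)

theorem trace_eq_rank {e : Matrix ι ι ℂ} (he : e * e = e) : e.trace = (e.rank : ℂ) := by
  have h : IsIdempotentElem (Matrix.toLin' e) := by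
    change Matrix.toLin' e * Matrix.toLin' e = Matrix.toLin' e
    rw [Module.End.mul_eq_comp, ← Matrix.toLin'_mul, he]
  have h2 := (LinearMap.IsIdempotentElem.isProj_range _ h).trace
  rw [Matrix.trace_toLin'_eq] at h2
  rw [h2]
  rfl

theorem rank_one_entries {e : Matrix ι ι ℂ} (he : e.rank = 1) (i j k l : ι) :
    e i j * e k l = e i l * e k j := by
  obtain ⟨v, -, hv⟩ := finrank_eq_one_iff'.1 he
  have key : ∀ j, ∃ c : ℂ, ∀ i, e i j = c * (v : ι → ℂ) i := by
    intro j
    obtain ⟨c, hc⟩ := hv ⟨e.mulVecLin (Pi.single j 1), LinearMap.mem_range_self _ _⟩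
    refine ⟨c, fun i => ?_⟩
    have := congrFun (congrArg Subtype.val hc) i
    simpa using this.symm
  obtain ⟨c, hc⟩ := key j
  obtain ⟨d, hd⟩ := key l
  rw [hc, hd, hd, hc]
  ring

/-- If the projections have rank one, so that `E` is a line bundle, then the class of `E` is
invertible with inverse the class of the dual bundle. -/
theorem cls_mul_cls_dual [ContinuousInv G] {n : ℕ} (E : EqBundle G X (Fin n))
    (hline : ∀ x, (E.proj x).rank = 1) : cls E * cls E.dual = 1 := by
  have hm := mk_eq_of_rel (KRel.mul E E.dual)
  rw [map_mul] at hm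
  have h1 := mk_eq_of_rel (KRel.one (G := G) (X := X))
  rw [map_one] at h1
  change _ = cls E * cls E.dual at hm
  rw [← hm, ← h1]
  refine mk_eq_of_rel (.iso _ _ ?_)
  let σ : Fin n × Fin n ≃ Fin (n * n) := finProdFinEquiv
  refine ⟨fun x => Matrix.of fun _ a => E.proj x (σ.symm a).2 (σ.symm a).1,
    fun x => Matrix.of fun a _ => E.proj x (σ.symm a).1 (σ.symm a).2, ?_, ?_, ?_, ?_, ?_, ?_⟩
  · exact continuous_matrix fun i j => E.continuous_proj.matrix_elem _ _
  · exact continuous_matrix fun i j => E.continuous_proj.matrix_elem _ _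
  · intro g x
    ext i a
    obtain rfl : i = 0 := Subsingleton.elim _ _
    have hg : E.rep g⁻¹ * E.rep g = 1 := by rw [← map_mul, inv_mul_cancel, map_one]
    have h : E.rep g⁻¹ * (E.proj (g • x) * E.rep g) = E.proj x := by
      rw [E.equivariant, ← mul_assoc, hg, one_mul]
    have h' := congrFun (congrFun h (σ.symm a).2) (σ.symm a).1
    simp only [Matrix.mul_apply, Finset.mul_sum] at h'
    simp only [Matrix.mul_apply, Matrix.of_apply]
    rw [← σ.sum_comp, Fintype.sum_prod_type, Finset.sum_comm]
    simp only [Equiv.symm_apply_apply]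
    refine Eq.trans ?_ (h'.trans ?_)
    · refine Finset.sum_congr rfl fun b _ => Finset.sum_congr rfl fun c _ => ?_
      change E.proj (g • x) b c * (E.rep g (σ.symm (σ (c, b))).1 (σ.symm a).1
        * E.rep g⁻¹ (σ.symm a).2 (σ.symm (σ (c, b))).2) = _
      rw [Equiv.symm_apply_apply]
      ring
    · simp [EqBundle.trivialLine]
  · intro g x
    ext a i
    obtain rfl : i = 0 := Subsingleton.elim _ _
    have h : E.proj (g • x) = E.rep g * E.proj x * E.rep g⁻¹ := by
      rw [← E.equivariant, mul_assoc, ← map_mul, mul_inv_cancel, map_one, mul_one]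
    have h' := congrFun (congrFun h (σ.symm a).1) (σ.symm a).2
    simp only [Matrix.mul_apply, Finset.sum_mul] at h'
    refine Eq.trans ?_ (h'.trans ?_)
    · simp [EqBundle.trivialLine, Matrix.mul_apply]
    · simp only [Matrix.mul_apply, Matrix.of_apply]
      rw [← σ.sum_comp, Fintype.sum_prod_type, Finset.sum_comm]
      refine Finset.sum_congr rfl fun b _ => Finset.sum_congr rfl fun c _ => ?_
      change _ = (E.rep g (σ.symm a).1 (σ.symm (σ (b, c))).1
        * E.rep g⁻¹ (σ.symm (σ (b, c))).2 (σ.symm a).2) * _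
      simp only [Equiv.symm_apply_apply]
      ring
  · intro x
    ext a b
    change _ = E.proj x (σ.symm a).1 (σ.symm b).1 * E.proj x (σ.symm b).2 (σ.symm a).2
    rw [rank_one_entries (hline x)]
    simp [Matrix.mul_apply]
  · intro x
    ext i j
    have ht := trace_eq_rank (E.idem x)
    rw [hline, ← E.idem x] at ht
    simp only [Matrix.trace, Matrix.diag, Matrix.mul_apply] at ht
    simp only [Matrix.mul_apply, Matrix.of_apply]
    rw [← σ.sum_comp, Fintype.sum_prod_type, Finset.sum_comm]
    simp only [Equiv.symm_apply_apply]
    rw [ht]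
    simp [EqBundle.trivialLine, Subsingleton.elim i j]

/-- The class of a line bundle as a unit of the K-ring. -/
noncomputable def lineUnit [ContinuousInv G] {n : ℕ} (E : EqBundle G X (Fin n))
    (hline : ∀ x, (E.proj x).rank = 1) : (KRing G X)ˣ where
  val := cls E
  inv := cls E.dual
  val_inv := cls_mul_cls_dual E hline
  inv_val := (mul_comm _ _).trans (cls_mul_cls_dual E hline)

end Bundles

/-! ### The flag manifold of `ℂ^(r+1)` -/

section Flags

variable (r : ℕ)

/-- `SU_{r+1}`. -/
abbrev SUGroup : Type := Matrix.specialUnitaryGroup (Fin (r + 1)) ℂ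

instance : ContinuousInv (SUGroup r) where
  continuous_inv :=
    Continuous.subtype_mk (continuous_subtype_val.matrix_conjTranspose) _

/-- `G = S¹ × SU_{r+1}`. -/
abbrev GGroup : Type := Circle × SUGroup r

/-- The maximal torus `S¹ × T^r` of `G`, where `T^r` consists of the `(Λ_0, …, Λ_r)` with
`Λ_0 ⋯ Λ_r = 1`. -/
abbrev TGroup : Type :=
  Circle × MonoidHom.ker (∏ j : Fin (r + 1), Pi.evalMonoidHom (fun _ : Fin (r + 1) => Circle) j)

/-- The embedding of the maximal torus of `SU_{r+1}` by diagonal matrices. -/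
noncomputable def torusToSU :
    MonoidHom.ker (∏ j : Fin (r + 1), Pi.evalMonoidHom (fun _ : Fin (r + 1) => Circle) j)
      →* SUGroup r where
  toFun t := ⟨Matrix.diagonal fun j => (t.1 j : ℂ), by
    have ht := t.2
    rw [MonoidHom.mem_ker, MonoidHom.finsetProd_apply] at ht
    rw [Matrix.mem_specialUnitaryGroup_iff, Matrix.mem_unitaryGroup_iff, Matrix.star_eq_conjTranspose,
      Matrix.diagonal_conjTranspose, Matrix.diagonal_mul_diagonal, Matrix.det_diagonal]
    refine ⟨?_, ?_⟩
    · rw [← Matrix.diagonal_one]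
      congr 1
      ext j
      simp [Complex.mul_conj, Circle.normSq_coe]
    · have := congrArg Circle.coeHom ht
      rw [map_prod, map_one] at this
      exact this⟩
  map_one' := by ext; simp
  map_mul' s t := by ext; simp

/-- The embedding of the maximal torus `S¹ × T^r` in `G = S¹ × SU_{r+1}`. -/
noncomputable def torusToG : TGroup r →* GGroup r := (MonoidHom.id Circle).prodMap (torusToSU r)

theorem continuous_circle_coe : Continuous (fun z : Circle => (z : ℂ)) :=
  continuous_subtype_val (p := fun z : ℂ => z ∈ Submonoid.unitSphere ℂ)

theorem continuous_torusToG : Continuous (torusToG r) := by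
  refine Continuous.prodMk continuous_fst (Continuous.comp (g := torusToSU r) ?_ continuous_snd)
  refine Continuous.subtype_mk ?_ _
  refine Continuous.matrix_diagonal (continuous_pi fun j => ?_)
  exact continuous_circle_coe.comp ((continuous_apply j).comp continuous_subtype_val)

/-- The manifold of complete flags `0 = E^0 ⊂ E^1 ⊂ ⋯ ⊂ E^{r+1} = ℂ^{r+1}`, `dim E^i = i`.
A flag is represented by the orthogonal projections `π i` onto its subspaces `E^i`; the condition
`π j * π i = π i` says that `π i` is a projection (`j = i`) and that `E^i ⊆ E^j`. -/
abbrev Flag : Type :=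
  {π : Fin (r + 2) → Matrix (Fin (r + 1)) (Fin (r + 1)) ℂ //
    (∀ i, (π i).IsHermitian) ∧ (∀ i, (π i).rank = i) ∧ ∀ i j, i ≤ j → π j * π i = π i}

variable {r}

theorem SUGroup.mul_conjTranspose (A : SUGroup r) : A.1 * A.1.conjTranspose = 1 :=
  Matrix.mem_unitaryGroup_iff.1 (Matrix.mem_specialUnitaryGroup_iff.1 A.2).1

theorem SUGroup.conjTranspose_mul (A : SUGroup r) : A.1.conjTranspose * A.1 = 1 :=
  Matrix.mem_unitaryGroup_iff'.1 (Matrix.mem_specialUnitaryGroup_iff.1 A.2).1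

/-- `G` acts on flags through the action of `SU_{r+1}` on `ℂ^{r+1}`; the circle acts trivially. -/
noncomputable instance : MulAction (GGroup r) (Flag r) where
  smul g F := ⟨fun i => g.2.1 * F.1 i * g.2.1.conjTranspose, by
    obtain ⟨π, h1, h2, h3⟩ := F
    refine ⟨fun i => Matrix.isHermitian_mul_mul_conjTranspose _ (h1 i), fun i => ?_,
      fun i j hij => ?_⟩
    · have hA : IsUnit g.2.1.det := by
        rw [(Matrix.mem_specialUnitaryGroup_iff.1 g.2.2).2]; exact isUnit_one
      have hA' : IsUnit g.2.1.conjTranspose.det := by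
        rw [Matrix.det_conjTranspose]; exact hA.star
      rw [Matrix.rank_mul_eq_left_of_isUnit_det _ _ hA',
        Matrix.rank_mul_eq_right_of_isUnit_det _ _ hA, h2]
    · change g.2.1 * π j * g.2.1.conjTranspose * (g.2.1 * π i * g.2.1.conjTranspose) = _
      calc g.2.1 * π j * g.2.1.conjTranspose * (g.2.1 * π i * g.2.1.conjTranspose)
          = g.2.1 * π j * (g.2.1.conjTranspose * g.2.1) * (π i * g.2.1.conjTranspose) := by
            simp only [mul_assoc]
        _ = g.2.1 * (π j * π i) * g.2.1.conjTranspose := by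
            rw [SUGroup.conjTranspose_mul]; simp only [mul_assoc, one_mul]
        _ = _ := by rw [h3 i j hij]⟩
  one_smul F := Subtype.ext (funext fun i => by
    change (1 : Matrix _ _ ℂ) * F.1 i * (1 : Matrix _ _ ℂ).conjTranspose = F.1 i
    simp)
  mul_smul g h F := Subtype.ext (funext fun i => by
    change (g.2.1 * h.2.1) * F.1 i * (g.2.1 * h.2.1).conjTranspose
      = g.2.1 * (h.2.1 * F.1 i * h.2.1.conjTranspose) * g.2.1.conjTranspose
    simp only [Matrix.conjTranspose_mul, mul_assoc])

theorem smul_flag (g : GGroup r) (F : Flag r) (i : Fin (r + 2)) :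
    (g • F).1 i * g.2.1 = g.2.1 * F.1 i := by
  change g.2.1 * F.1 i * g.2.1.conjTranspose * g.2.1 = _
  rw [mul_assoc, SUGroup.conjTranspose_mul, mul_one]

/-- The tautological line bundle `E^{j+1} / E^j` over the flag manifold, for `0 ≤ j ≤ r`, realized
as the orthogonal complement of `E^j` in `E^{j+1}` inside the trivial bundle `ℂ^{r+1}`. -/
noncomputable def tautLine (j : Fin (r + 1)) : EqBundle (GGroup r) (Flag r) (Fin (r + 1)) where
  rep := (Submonoid.subtype _).comp (MonoidHom.snd Circle (SUGroup r))
  continuous_rep := continuous_subtype_val.comp continuous_snd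
  proj F := F.1 j.succ - F.1 j.castSucc
  continuous_proj := ((continuous_apply _).comp continuous_subtype_val).sub
    ((continuous_apply _).comp continuous_subtype_val)
  idem F := by
    have h1 := F.2.2.2 j.succ j.succ le_rfl
    have h2 := F.2.2.2 j.castSucc j.castSucc le_rfl
    have h3 := F.2.2.2 j.castSucc j.succ j.castSucc_lt_succ.le
    have h4 : F.1 j.castSucc * F.1 j.succ = F.1 j.castSucc := by
      have := congrArg Matrix.conjTranspose h3
      rwa [Matrix.conjTranspose_mul, (F.2.1 _).eq, (F.2.1 _).eq] at this
    rw [sub_mul, mul_sub, mul_sub, h1, h2, h3, h4]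
    simp
  equivariant g F := by
    change ((g • F).1 j.succ - (g • F).1 j.castSucc) * g.2.1
      = g.2.1 * (F.1 j.succ - F.1 j.castSucc)
    rw [sub_mul, mul_sub, smul_flag, smul_flag]

theorem tautLine_rank (j : Fin (r + 1)) (F : Flag r) : ((tautLine j).proj F).rank = 1 := by
  have h := trace_eq_rank ((tautLine j).idem F)
  have h1 := trace_eq_rank (F.2.2.2 j.succ j.succ le_rfl)
  have h2 := trace_eq_rank (F.2.2.2 j.castSucc j.castSucc le_rfl)
  have h3 : ((tautLine j).proj F).trace = (F.1 j.succ).trace - (F.1 j.castSucc).trace :=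
    Matrix.trace_sub _ _
  rw [h1, h2, h, F.2.2.1, F.2.2.1] at h3
  have : (((tautLine j).proj F).rank : ℂ) = (1 : ℕ) := by rw [h3]; simp
  exact_mod_cast this

/-- The one-dimensional representation `(s, A) ↦ s` of `G = S¹ × SU_{r+1}`. -/
noncomputable def circleChar : EqBundle (GGroup r) PUnit (Fin 1) where
  rep := (Matrix.scalar (Fin 1)).toMonoidHom.comp
    (Circle.coeHom.comp (MonoidHom.fst Circle (SUGroup r)))
  continuous_rep := Continuous.matrix_diagonal
    (continuous_pi fun _ => continuous_circle_coe.comp continuous_fst)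
  proj _ := 1
  continuous_proj := continuous_const
  idem _ := by simp
  equivariant _ _ := by simp

end Flags

/-! ### The coefficient ring -/

section Coefficients

variable (r : ℕ)

/-- `K_G(pt)`, the representation ring of `G`. -/
abbrev RepG : Type := KRing (GGroup r) PUnit

/-- The representation ring of the maximal torus `S¹ × T^r` of `G`, that is, the ring of Laurent
polynomials in `Λ, q`. -/
abbrev RepT : Type := KRing (TGroup r) PUnit

/-- `K_G(X)` for the flag manifold `X`. -/
abbrev KFlag : Type := KRing (GGroup r) (Flag r)

/-- Restriction of representations from `G` to its maximal torus. -/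
noncomputable instance : Algebra (RepG r) (RepT r) :=
  (kPull (torusToG r) (continuous_torusToG r) id continuous_id (fun _ _ => rfl)).toAlgebra

/-- `K_G(X)` is a `K_G(pt)`-algebra by pull-back along `X → pt`. -/
noncomputable instance : Algebra (RepG r) (KFlag r) :=
  (kPull (MonoidHom.id (GGroup r)) continuous_id (fun _ => PUnit.unit) continuous_const
    (fun _ _ => rfl)).toAlgebra

/-- The field `ℚ(Λ, q)` of rational functions on the maximal torus of `G`. -/
abbrev Scalars : Type := FractionRing (RepT r)

/-- The ring `K_G(X) ⊗ ℚ(Λ, q)`, the tensor product being over `K_G(pt)`. -/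
def KLoc : Type := TensorProduct (RepG r) (Scalars r) (KFlag r)

noncomputable instance : CommRing (KLoc r) :=
  inferInstanceAs (CommRing (TensorProduct (RepG r) (Scalars r) (KFlag r)))

noncomputable instance : Algebra (Scalars r) (KLoc r) :=
  inferInstanceAs (Algebra (Scalars r) (TensorProduct (RepG r) (Scalars r) (KFlag r)))

/-- The canonical homomorphism `K_G(X) → K_G(X) ⊗ ℚ(Λ, q)`, `a ↦ 1 ⊗ a`. -/
noncomputable def toKLoc : KFlag r →+* KLoc r :=
  (Algebra.TensorProduct.includeRight (R := RepG r) (A := Scalars r) (B := KFlag r)).toRingHom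

variable {r}

/-- The coordinate `q` on `S¹`, as a unit of `K_G(X) ⊗ ℚ(Λ, q)`. -/
noncomputable def q : (KLoc r)ˣ :=
  Units.map ((toKLoc r).comp (algebraMap (RepG r) (KFlag r))).toMonoidHom
    (lineUnit circleChar fun _ => by simp [circleChar, Matrix.rank_one])

/-- The line bundles `p_1, …, p_r` (here `p i` with `i = 0, …, r - 1` is `p_{i+1}`), as units of
`K_G(X) ⊗ ℚ(Λ, q)`: `p_i` is the determinant `Λ^i E^i = ⨂_{j < i} E^{j+1} / E^j` of the tautological
bundle `E^i`, which is the pull-back of the Hopf bundle under the `i`-th Plücker map. -/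
noncomputable def p (i : Fin r) : (KLoc r)ˣ :=
  ∏ j : Fin (r + 1) with j ≤ i.castSucc,
    Units.map (toKLoc r).toMonoidHom (lineUnit (tautLine j) (tautLine_rank j))

end Coefficients

/-! ### Finite-difference operators -/

section Operators

variable (r : ℕ)

/-- Formal series `p^{ln Q / ln q} ∑_d I_d Q^d` with coefficients `I_d ∈ K_G(X) ⊗ ℚ(Λ, q)`, where
`p^{ln Q / ln q} = ∏_i p_i^{ln Q_i / ln q}`.  Such an expression is represented by the power series
`∑_d I_d Q^d`; the common factor `p^{ln Q / ln q}` enters through the action `shift` of translations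
on it. -/
abbrev TwistedSeries : Type := MvPowerSeries (Fin r) (KLoc r)

variable {r}

/-- The translation `q^{m·∂/∂t} = ∏_j q^{m_j ∂/∂t_j}`, `t_j ↦ t_j + m_j ln q`, acting on the series
`p^{ln Q / ln q} ∑_d I_d Q^d` in the variables `Q_i = e^{t_{i-1} - t_i}`.  As
`ln Q_i ↦ ln Q_i + (m_{i-1} - m_i) ln q`, it multiplies `p^{ln Q / ln q} Q^d` by
`∏_i (p_i q^{d_i})^{m_{i-1} - m_i}`. -/
noncomputable def shift (m : Fin (r + 1) → ℤ) : Module.End (KLoc r) (TwistedSeries r) where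
  toFun I := fun d => ((∏ i : Fin r, (p i * q ^ d i) ^ (m i.castSucc - m i.succ) : (KLoc r)ˣ) :
    KLoc r) * MvPowerSeries.coeff d I
  map_add' I J := by
    ext d
    change _ * MvPowerSeries.coeff d (I + J) =
      _ * MvPowerSeries.coeff d I + _ * MvPowerSeries.coeff d J
    rw [map_add, mul_add]
  map_smul' c I := by
    ext d
    change _ * MvPowerSeries.coeff d (c • I) = c * (_ * MvPowerSeries.coeff d I)
    rw [map_smul, smul_eq_mul, mul_left_comm]

/-- Multiplication by a polynomial in `Q`. -/
noncomputable def mulPoly (P : MvPolynomial (Fin r) (KLoc r)) : Module.End (KLoc r) (TwistedSeries r) :=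
  LinearMap.mulLeft (KLoc r) (P : MvPowerSeries (Fin r) (KLoc r))

/-- The finite-difference operator `∑_m c_m(Q) q^{m·∂/∂t}` (a finite sum) with coefficients `c_m`
polynomial in `Q`. -/
noncomputable def diffOp (c : (Fin (r + 1) → ℤ) →₀ MvPolynomial (Fin r) (KLoc r)) :
    Module.End (KLoc r) (TwistedSeries r) :=
  c.sum fun m P => mulPoly P * shift m

variable (r) in
/-- The finite-difference Toda operator
`q^{∂/∂t_0} + ∑_{i=1}^r q^{∂/∂t_i} (1 - e^{t_{i-1} - t_i})`. -/
noncomputable def toda : Module.End (KLoc r) (TwistedSeries r) :=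
  shift (Pi.single 0 1) +
    ∑ i : Fin r, shift (Pi.single i.succ 1) * mulPoly (1 - MvPolynomial.X i)

end Operators

end QToda

set_option linter.unusedSectionVars false

/-! Put J = D̂I − Λ_D I. As Ĥ is K-linear and commutes with D̂, also ĤJ = Λ_H J, and the congruence
says that J has no constant term. So the point is that such a J vanishes (`eq_zero_of_toda_eq`).

The translation q^{∂/∂t_j} multiplies p^{ln Q/ln q}Q^d by P_j q^{a_j}, where P_j is the class of
E^{j+1}/E^j and a_j is a difference of neighbouring exponents of Q^d. At a monomial d all of whose
predecessors have zero coefficient, the terms of Ĥ containing some Q_i drop out, and the eigenvalue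
equation reads (∑ P_j q^{a_j} − Λ_H) J_d = 0. For I at d = 0 it reads (∑ P_j − Λ_H) I_0 = 0. Since ∑
P_j is the scalar ∑ Λ_j, and scalars form a field, Λ_H = ∑ Λ_j (`eigenvalue_eq`).

The crux is `isUnit_symbol_sub`: for a ≠ 0 the element ∑ P_j q^{a_j} − ∑ Λ_j is a unit of K. No
basis of K is needed, only the relations ∏_k (P_i − Λ_k) = 0. If the element lay in a maximal ideal,
then in the residue field, an extension of ℚ(Λ, q), each P_i would become some Λ_{f(i)}, giving ∑
Λ_{f(j)} q^{a_j} = ∑ Λ_j in the representation ring of the torus. Independence of characters forces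
a = 0, hence d = 0.

Two facts from K-theory feed this. First, the exterior powers of ℂ^{r+1} become elementary symmetric
functions of the P_j over the flag manifold and of the Λ_j on the torus (`bcls_extPower`), and
tensoring over K_G(pt) identifies the two. Second, the representation ring of the torus is the group
ring of a torsion-free character group, hence a domain, so its fraction ring is a field. -/

namespace QToda

/-! ### Calculus of bundle classes: isomorphisms, sums, tensor products, orthogonal decompositions.
-/

section BundleCalculus

variable {G : Type} [Group G] [TopologicalSpace G]
variable {X : Type} [TopologicalSpace X] [MulAction G X]
variable {ι κ : Type} [Fintype ι] [DecidableEq ι] [Fintype κ] [DecidableEq κ]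

namespace EqBundle

theorem Iso.symm {E : EqBundle G X ι} {F : EqBundle G X κ} (h : E.Iso F) : F.Iso E := by
  obtain ⟨u, v, hu, hv, h1, h2, h3, h4⟩ := h
  exact ⟨v, u, hv, hu, h2, h1, h4, h3⟩

theorem Iso.trans {μ : Type} [Fintype μ] [DecidableEq μ] {E : EqBundle G X ι}
    {F : EqBundle G X κ} {H : EqBundle G X μ} (h : E.Iso F) (h' : F.Iso H) : E.Iso H := by
  obtain ⟨u, v, hu, hv, h1, h2, h3, h4⟩ := h
  obtain ⟨u', v', hu', hv', h1', h2', h3', h4'⟩ := h'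
  refine ⟨fun x => u' x * F.proj x * u x, fun x => v x * F.proj x * v' x,
    (hu'.matrix_mul F.continuous_proj).matrix_mul hu,
    (hv.matrix_mul F.continuous_proj).matrix_mul hv', fun g x => ?_, fun g x => ?_, fun x => ?_,
    fun x => ?_⟩
  · change u' (g • x) * F.proj (g • x) * u (g • x) * E.rep g = H.rep g * (u' x * F.proj x * u x)
    rw [Matrix.mul_assoc, h1, ← Matrix.mul_assoc, Matrix.mul_assoc (u' _), F.equivariant,
      ← Matrix.mul_assoc, h1']
    simp only [Matrix.mul_assoc]
  · change v (g • x) * F.proj (g • x) * v' (g • x) * H.rep g = E.rep g * (v x * F.proj x * v' x)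
    rw [Matrix.mul_assoc, h2', ← Matrix.mul_assoc, Matrix.mul_assoc (v _), F.equivariant,
      ← Matrix.mul_assoc, h2]
    simp only [Matrix.mul_assoc]
  · calc v x * F.proj x * v' x * (u' x * F.proj x * u x)
        = v x * F.proj x * (v' x * u' x) * F.proj x * u x := by simp only [Matrix.mul_assoc]
      _ = v x * (F.proj x * F.proj x * F.proj x) * u x := by
        rw [h3']; simp only [Matrix.mul_assoc]
      _ = (v x * u x) * (v x * u x) := by
        rw [F.idem, F.idem, ← h4]; simp only [Matrix.mul_assoc]
      _ = E.proj x := by rw [h3, E.idem]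
  · calc u' x * F.proj x * u x * (v x * F.proj x * v' x)
        = u' x * F.proj x * (u x * v x) * F.proj x * v' x := by simp only [Matrix.mul_assoc]
      _ = u' x * (F.proj x * F.proj x * F.proj x) * v' x := by
        rw [h4]; simp only [Matrix.mul_assoc]
      _ = (u' x * v' x) * (u' x * v' x) := by
        rw [F.idem, F.idem, ← h3']; simp only [Matrix.mul_assoc]
      _ = H.proj x := by rw [h4', H.idem]

theorem iso_reindex (e : ι ≃ κ) (E : EqBundle G X ι) : E.Iso (E.reindex e) := by
  refine ⟨fun x => (E.proj x).submatrix e.symm id, fun x => (E.proj x).submatrix id e.symm,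
    E.continuous_proj.matrix_submatrix _ _, E.continuous_proj.matrix_submatrix _ _,
    fun g x => ?_, fun g x => ?_, fun x => ?_, fun x => ?_⟩
  · have h : (E.reindex e).rep g = (E.rep g).submatrix e.symm e.symm := rfl
    beta_reduce
    rw [h]
    nth_rw 1 [← Matrix.submatrix_id_id (E.rep g)]
    rw [← Matrix.submatrix_mul _ _ _ _ _ Function.bijective_id,
      E.equivariant,
      ← Matrix.submatrix_mul _ _ _ _ _ e.symm.bijective]
  · have h : (E.reindex e).rep g = (E.rep g).submatrix e.symm e.symm := rfl
    beta_reduce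
    rw [h, ← Matrix.submatrix_mul _ _ _ _ _ e.symm.bijective, E.equivariant]
    nth_rw 2 [← Matrix.submatrix_id_id (E.rep g)]
    rw [← Matrix.submatrix_mul _ _ _ _ _ Function.bijective_id]
  · rw [← Matrix.submatrix_mul _ _ _ _ _ e.symm.bijective, E.idem, Matrix.submatrix_id_id]
  · rw [← Matrix.submatrix_mul _ _ _ _ _ Function.bijective_id, E.idem]
    rfl

end EqBundle

/-- The class in the K-ring of a bundle whose ambient representation is indexed by any finite
type. -/
noncomputable def bcls (E : EqBundle G X ι) : KRing G X := cls (E.reindex (Fintype.equivFin ι))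

theorem cls_eq_of_iso {m n : ℕ} {E : EqBundle G X (Fin m)} {F : EqBundle G X (Fin n)}
    (h : E.Iso F) : cls E = cls F := mk_eq_of_rel (.iso E F h)

theorem bcls_eq_of_iso {E : EqBundle G X ι} {F : EqBundle G X κ} (h : E.Iso F) :
    bcls E = bcls F :=
  cls_eq_of_iso (((EqBundle.iso_reindex _ E).symm.trans h).trans (EqBundle.iso_reindex _ F))

theorem bcls_eq_cls {n : ℕ} (E : EqBundle G X (Fin n)) : bcls E = cls E :=
  cls_eq_of_iso (EqBundle.iso_reindex _ E).symm

theorem EqBundle.Iso.directSum_congr {ι' κ' : Type} [Fintype ι'] [DecidableEq ι'] [Fintype κ']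
    [DecidableEq κ'] {E : EqBundle G X ι} {E' : EqBundle G X ι'}
    {F : EqBundle G X κ} {F' : EqBundle G X κ'} (h : E.Iso E') (h' : F.Iso F') :
    (E.directSum F).Iso (E'.directSum F') := by
  obtain ⟨u, v, hu, hv, h1, h2, h3, h4⟩ := h
  obtain ⟨u', v', hu', hv', h1', h2', h3', h4'⟩ := h'
  refine ⟨fun x => Matrix.fromBlocks (u x) 0 0 (u' x), fun x => Matrix.fromBlocks (v x) 0 0 (v' x),
    hu.matrix_fromBlocks continuous_const continuous_const hu',
    hv.matrix_fromBlocks continuous_const continuous_const hv', ?_, ?_, ?_, ?_⟩ <;> intros <;>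
  simp [EqBundle.directSum, Matrix.fromBlocks_multiply, *]

theorem EqBundle.Iso.tensor_congr {ι' κ' : Type} [Fintype ι'] [DecidableEq ι'] [Fintype κ']
    [DecidableEq κ'] {E : EqBundle G X ι} {E' : EqBundle G X ι'}
    {F : EqBundle G X κ} {F' : EqBundle G X κ'} (h : E.Iso E') (h' : F.Iso F') :
    (E.tensor F).Iso (E'.tensor F') := by
  obtain ⟨u, v, hu, hv, h1, h2, h3, h4⟩ := h
  obtain ⟨u', v', hu', hv', h1', h2', h3', h4'⟩ := h'
  refine ⟨fun x => Matrix.kronecker (u x) (u' x), fun x => Matrix.kronecker (v x) (v' x),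
    continuous_matrix fun i j => (hu.matrix_elem i.1 j.1).mul (hu'.matrix_elem i.2 j.2),
    continuous_matrix fun i j => (hv.matrix_elem i.1 j.1).mul (hv'.matrix_elem i.2 j.2),
    ?_, ?_, ?_, ?_⟩ <;> intros <;>
  refine (Matrix.mul_kronecker_mul _ _ _ _).symm.trans ?_
  · rw [h1, h1']; exact Matrix.mul_kronecker_mul _ _ _ _
  · rw [h2, h2']; exact Matrix.mul_kronecker_mul _ _ _ _
  · rw [h3, h3']; rfl
  · rw [h4, h4']; rfl

theorem bcls_directSum (E : EqBundle G X ι) (F : EqBundle G X κ) :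
    bcls (E.directSum F) = bcls E + bcls F := by
  have h := mk_eq_of_rel (KRel.add (E.reindex (Fintype.equivFin ι)) (F.reindex (Fintype.equivFin κ)))
  rw [map_add] at h
  refine Eq.trans ?_ h
  change _ = cls _
  rw [← bcls_eq_cls]
  exact bcls_eq_of_iso (((EqBundle.iso_reindex _ E).directSum_congr
    (EqBundle.iso_reindex _ F)).trans (EqBundle.iso_reindex _ _))

theorem bcls_tensor (E : EqBundle G X ι) (F : EqBundle G X κ) :
    bcls (E.tensor F) = bcls E * bcls F := by
  have h := mk_eq_of_rel (KRel.mul (E.reindex (Fintype.equivFin ι)) (F.reindex (Fintype.equivFin κ)))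
  rw [map_mul] at h
  refine Eq.trans ?_ h
  change _ = cls _
  rw [← bcls_eq_cls]
  exact bcls_eq_of_iso (((EqBundle.iso_reindex _ E).tensor_congr
    (EqBundle.iso_reindex _ F)).trans (EqBundle.iso_reindex _ _))

/-- The subbundle of `E` cut out by a continuous equivariant family of idempotents of the ambient
representation. -/
@[simps]
def EqBundle.cut (E : EqBundle G X ι) (e : X → Matrix ι ι ℂ) (hc : Continuous e)
    (he : ∀ x, e x * e x = e x) (heq : ∀ g x, e (g • x) * E.rep g = E.rep g * e x) :
    EqBundle G X ι where
  rep := E.rep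
  continuous_rep := E.continuous_rep
  proj := e
  continuous_proj := hc
  idem := he
  equivariant := heq

/-- The zero maps exhibit an isomorphism between E and E ⊕ E, so the class equals its double. -/
theorem bcls_eq_zero {E : EqBundle G X ι} (h : ∀ x, E.proj x = 0) : bcls E = 0 := by
  have : E.Iso (E.directSum E) := by
    refine ⟨0, 0, continuous_const, continuous_const, ?_, ?_, ?_, ?_⟩ <;> intros <;>
      simp [h, EqBundle.directSum]
  simpa [bcls_directSum] using bcls_eq_of_iso this

/-- Bundles in the same representation, with orthogonal projections, add up. -/
theorem bcls_add {E F H : EqBundle G X ι} (hE : E.rep = H.rep) (hF : F.rep = H.rep)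
    (hH : ∀ x, H.proj x = E.proj x + F.proj x) (h1 : ∀ x, E.proj x * F.proj x = 0)
    (h2 : ∀ x, F.proj x * E.proj x = 0) : bcls H = bcls E + bcls F := by
  rw [← bcls_directSum]
  refine bcls_eq_of_iso ⟨fun x => Matrix.fromRows (E.proj x) (F.proj x),
    fun x => Matrix.fromCols (E.proj x) (F.proj x), ?_, ?_, fun g x => ?_, fun g x => ?_,
    fun x => ?_, fun x => ?_⟩
  · refine continuous_matrix fun i j => ?_
    cases i
    · exact E.continuous_proj.matrix_elem _ _
    · exact F.continuous_proj.matrix_elem _ _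
  · refine continuous_matrix fun i j => ?_
    cases j
    · exact E.continuous_proj.matrix_elem _ _
    · exact F.continuous_proj.matrix_elem _ _
  · have a := E.equivariant g x
    have b := F.equivariant g x
    rw [hE] at a
    rw [hF] at b
    simp [EqBundle.directSum, Matrix.fromRows_mul, Matrix.fromBlocks_mul_fromRows, a, b, hE, hF]
  · have a := E.equivariant g x
    have b := F.equivariant g x
    rw [hE] at a
    rw [hF] at b
    simp [EqBundle.directSum, Matrix.mul_fromCols, Matrix.fromCols_mul_fromBlocks, a, b, hE, hF]
  · simp [Matrix.fromCols_mul_fromRows, hH, E.idem, F.idem]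
  · simp [EqBundle.directSum, E.idem, F.idem, h1, h2]

theorem bcls_finset_sum {J : Type} [DecidableEq J] (s : Finset J) (E : J → EqBundle G X ι)
    (H : EqBundle G X ι) (hE : ∀ j ∈ s, (E j).rep = H.rep)
    (hH : ∀ x, H.proj x = ∑ j ∈ s, (E j).proj x)
    (horth : ∀ i ∈ s, ∀ j ∈ s, i ≠ j → ∀ x, (E i).proj x * (E j).proj x = 0) :
    bcls H = ∑ j ∈ s, bcls (E j) := by
  induction s using Finset.induction_on generalizing H with
  | empty => exact bcls_eq_zero (by simpa using hH)
  | insert a s ha ih =>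
    have hid : ∀ x, (∑ j ∈ s, (E j).proj x) * (∑ j ∈ s, (E j).proj x) = ∑ j ∈ s, (E j).proj x := by
      intro x
      rw [Finset.sum_mul]
      refine Finset.sum_congr rfl fun i hi => ?_
      rw [Finset.mul_sum, Finset.sum_eq_single i]
      · exact (E i).idem x
      · exact fun j hj hji => horth i (by simp [hi]) j (by simp [hj]) hji.symm x
      · exact fun h => absurd hi h
    have heq : ∀ g x, (∑ j ∈ s, (E j).proj (g • x)) * H.rep g
        = H.rep g * ∑ j ∈ s, (E j).proj x := by
      intro g x
      rw [Finset.sum_mul, Finset.mul_sum]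
      refine Finset.sum_congr rfl fun i hi => ?_
      rw [← hE i (by simp [hi])]
      exact (E i).equivariant g x
    let F := H.cut (fun x => ∑ j ∈ s, (E j).proj x)
      (continuous_finsetSum _ fun j _ => (E j).continuous_proj) hid heq
    rw [Finset.sum_insert ha, ← ih F (fun j hj => hE j (by simp [hj])) (fun x => rfl)
      (fun i hi j hj => horth i (by simp [hi]) j (by simp [hj]))]
    refine bcls_add (hE a (by simp)) rfl (fun x => ?_) (fun x => ?_) (fun x => ?_)
    · rw [hH, Finset.sum_insert ha]; rfl
    · change _ * ∑ j ∈ s, (E j).proj x = 0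
      rw [Finset.mul_sum]
      exact Finset.sum_eq_zero fun j hj => horth a (by simp) j (by simp [hj])
        (by rintro rfl; exact ha hj) x
    · change (∑ j ∈ s, (E j).proj x) * _ = 0
      rw [Finset.sum_mul]
      exact Finset.sum_eq_zero fun j hj => horth j (by simp [hj]) a (by simp)
        (by rintro rfl; exact ha hj) x

theorem kPull_bcls {H : Type} [Group H] [TopologicalSpace H] {Y : Type} [TopologicalSpace Y]
    [MulAction H Y] (φ : H →* G) (hφ : Continuous φ) (f : Y → X) (hf : Continuous f)
    (hfe : ∀ h y, f (h • y) = φ h • f y) (E : EqBundle G X ι) :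
    kPull φ hφ f hf hfe (bcls E) = bcls (E.pull φ hφ f hf hfe) := by
  refine (Ideal.Quotient.lift_mk _ _ _).trans ?_
  simp only [gen, MvPolynomial.coe_eval₂Hom, MvPolynomial.eval₂_X]
  rfl

end BundleCalculus

/-! ### Exterior powers of a sum of line bundles. -/

section ExteriorPowers

variable {G : Type} [Group G] [TopologicalSpace G]
variable {X : Type} [TopologicalSpace X] [MulAction G X]
variable {ι : Type} [Fintype ι] [DecidableEq ι]

/-- The tensor product of a family of matrices, acting on a tensor power. -/
def tensorMatrix {k : ℕ} (M : Fin k → Matrix ι ι ℂ) : Matrix (Fin k → ι) (Fin k → ι) ℂ :=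
  Matrix.of fun f h => ∏ i, M i (f i) (h i)

theorem tensorMatrix_mul {k : ℕ} (M N : Fin k → Matrix ι ι ℂ) :
    tensorMatrix M * tensorMatrix N = tensorMatrix fun i => M i * N i := by
  ext f h
  simp only [tensorMatrix, Matrix.mul_apply, Matrix.of_apply, ← Finset.prod_mul_distrib,
    Finset.prod_univ_sum, Fintype.piFinset_univ]

theorem tensorMatrix_one {k : ℕ} : tensorMatrix (fun _ : Fin k => (1 : Matrix ι ι ℂ)) = 1 := by
  ext f h
  simp only [tensorMatrix, Matrix.of_apply, Matrix.one_apply, Finset.prod_ite_zero,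
    Finset.mem_univ, true_imp_iff, funext_iff, Finset.prod_const_one]

theorem sum_tensorMatrix {k : ℕ} {J : Type} [Fintype J] [DecidableEq J]
    (π : J → Matrix ι ι ℂ) :
    ∑ a : Fin k → J, tensorMatrix (fun i => π (a i)) = tensorMatrix fun _ => ∑ j, π j := by
  ext f h
  simp only [tensorMatrix, Matrix.sum_apply, Matrix.of_apply, Finset.prod_univ_sum,
    Fintype.piFinset_univ]

theorem tensorMatrix_eq_zero {k : ℕ} {M : Fin k → Matrix ι ι ℂ} (i : Fin k) (h : M i = 0) :
    tensorMatrix M = 0 := by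
  ext f g
  exact Finset.prod_eq_zero (Finset.mem_univ i) (by rw [h]; rfl)

theorem continuous_tensorMatrix {Y : Type} [TopologicalSpace Y] {k : ℕ}
    {M : Fin k → Y → Matrix ι ι ℂ} (h : ∀ i, Continuous (M i)) :
    Continuous fun y => tensorMatrix fun i => M i y :=
  continuous_matrix fun f g => continuous_finsetProd Finset.univ fun i _ =>
    (h i).matrix_elem (f i) (g i)

theorem EqBundle.ext_rep_proj {E F : EqBundle G X ι} (h : E.rep = F.rep) (h' : E.proj = F.proj) :
    E = F := by
  cases E
  cases F
  cases h
  cases h'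
  rfl

/-- The tensor product of a family of bundles. -/
def EqBundle.tensorFamily {k : ℕ} (L : Fin k → EqBundle G X ι) : EqBundle G X (Fin k → ι) where
  rep :=
    { toFun := fun g => tensorMatrix fun i => (L i).rep g
      map_one' := by simp [tensorMatrix_one]
      map_mul' := fun g h => by simp [tensorMatrix_mul] }
  continuous_rep := continuous_tensorMatrix fun i => (L i).continuous_rep
  proj x := tensorMatrix fun i => (L i).proj x
  continuous_proj := continuous_tensorMatrix fun i => (L i).continuous_proj
  idem x := by simp [tensorMatrix_mul, (L _).idem]
  equivariant g x := by
    change tensorMatrix _ * tensorMatrix _ = tensorMatrix _ * tensorMatrix _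
    simp [tensorMatrix_mul, (L _).equivariant]

theorem bcls_tensorFamily {k : ℕ} (L : Fin k → EqBundle G X ι) :
    bcls (EqBundle.tensorFamily L) = ∏ i, bcls (L i) := by
  induction k with
  | zero =>
    have h1 : cls (EqBundle.trivialLine G X) = 1 := (mk_eq_of_rel KRel.one).trans (map_one _)
    rw [Fin.prod_univ_zero, ← h1, ← bcls_eq_cls]
    refine bcls_eq_of_iso ⟨fun _ => Matrix.of fun _ _ => 1, fun _ => Matrix.of fun _ _ => 1,
      continuous_const, continuous_const, ?_, ?_, ?_, ?_⟩ <;> intros <;> ext i j <;>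
      simp [Matrix.mul_apply, EqBundle.tensorFamily, EqBundle.trivialLine, tensorMatrix,
        Matrix.one_apply, eq_iff_true_of_subsingleton]
  | succ k ih =>
    rw [Fin.prod_univ_succ, ← ih, ← bcls_tensor]
    rw [bcls_eq_of_iso (EqBundle.iso_reindex (Fin.consEquiv fun _ => ι) ((L 0).tensor _))]
    congr 1
    refine EqBundle.ext_rep_proj (MonoidHom.ext fun g => ?_) (funext fun x => ?_) <;>
    · ext f h
      simp only [EqBundle.tensorFamily, tensorMatrix, MonoidHom.coe_mk, OneHom.coe_mk,
        Matrix.of_apply, Fin.prod_univ_succ]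
      rfl

/-- The matrix of the permutation `σ` of the tensor factors. -/
def permTensor (ι : Type) [DecidableEq ι] {k : ℕ} (σ : Equiv.Perm (Fin k)) : Matrix (Fin k → ι) (Fin k → ι) ℂ :=
  Matrix.of fun f h => if f ∘ σ = h then 1 else 0

variable {k : ℕ} (σ τ : Equiv.Perm (Fin k))

theorem permTensor_mul_apply (M : Matrix (Fin k → ι) (Fin k → ι) ℂ) (f h : Fin k → ι) :
    (permTensor ι σ * M) f h = M (f ∘ σ) h := by
  simp [permTensor, Matrix.mul_apply]

theorem mul_permTensor_apply (M : Matrix (Fin k → ι) (Fin k → ι) ℂ) (f h : Fin k → ι) :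
    (M * permTensor ι σ) f h = M f (h ∘ σ.symm) := by
  have (g : Fin k → ι) : g ∘ σ = h ↔ g = h ∘ σ.symm := (Equiv.eq_comp_symm σ g h).symm
  simp [permTensor, Matrix.mul_apply, this]

theorem permTensor_mul : permTensor ι σ * permTensor ι τ = permTensor ι (σ * τ) := by
  ext f h
  rw [permTensor_mul_apply]
  rfl

theorem permTensor_one : permTensor ι (1 : Equiv.Perm (Fin k)) = 1 := by
  ext f h
  simp [permTensor, Matrix.one_apply]

theorem permTensor_mul_tensorMatrix (M : Fin k → Matrix ι ι ℂ) :
    permTensor ι σ * tensorMatrix M = tensorMatrix (M ∘ σ.symm) * permTensor ι σ := by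
  ext f h
  rw [permTensor_mul_apply, mul_permTensor_apply]
  refine Fintype.prod_equiv σ _ _ fun i => ?_
  simp

/-- The antisymmetrizing projection of a tensor power. -/
noncomputable def antisym (ι : Type) [Fintype ι] [DecidableEq ι] (k : ℕ) :
    Matrix (Fin k → ι) (Fin k → ι) ℂ :=
  (k.factorial : ℂ)⁻¹ • ∑ σ : Equiv.Perm (Fin k), ((σ.sign : ℤ) : ℂ) • permTensor ι σ

theorem sign_mul_self_cast : ((σ.sign : ℤ) : ℂ) * ((σ.sign : ℤ) : ℂ) = 1 := by
  rw [← Int.cast_mul, ← Units.val_mul, Int.units_mul_self]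
  simp

theorem antisym_mul_permTensor :
    antisym ι k * permTensor ι τ = ((τ.sign : ℤ) : ℂ) • antisym ι k := by
  rw [antisym, smul_mul_assoc, smul_comm ((τ.sign : ℤ) : ℂ)]
  congr 1
  rw [Finset.sum_mul, Finset.smul_sum]
  refine Fintype.sum_equiv (Equiv.mulRight τ)
    (fun σ => ((σ.sign : ℤ) : ℂ) • permTensor ι σ * permTensor ι τ)
    (fun σ => ((τ.sign : ℤ) : ℂ) • ((σ.sign : ℤ) : ℂ) • permTensor ι σ) fun σ => ?_
  rw [Equiv.coe_mulRight, smul_mul_assoc, permTensor_mul, smul_smul, Equiv.Perm.sign_mul,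
    Units.val_mul, Int.cast_mul, mul_left_comm, sign_mul_self_cast, mul_one]

theorem commute_antisym {M : Matrix (Fin k → ι) (Fin k → ι) ℂ}
    (h : ∀ σ : Equiv.Perm (Fin k), permTensor ι σ * M = M * permTensor ι σ) :
    antisym ι k * M = M * antisym ι k := by
  simp only [antisym, smul_mul_assoc, mul_smul_comm, Finset.sum_mul, Finset.mul_sum, h]

theorem antisym_idem : antisym ι k * antisym ι k = antisym ι k := by
  have h : antisym ι k * ((k.factorial : ℂ)⁻¹ •
      ∑ σ : Equiv.Perm (Fin k), ((σ.sign : ℤ) : ℂ) • permTensor ι σ) = antisym ι k := by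
    simp only [mul_smul_comm, Finset.mul_sum, antisym_mul_permTensor, smul_smul,
      sign_mul_self_cast, one_smul, Finset.sum_const, Finset.card_univ, Fintype.card_perm,
      Fintype.card_fin]
    rw [← Nat.cast_smul_eq_nsmul ℂ, smul_smul, inv_mul_cancel₀, one_smul]
    exact_mod_cast k.factorial_ne_zero
  exact h

/-- The exterior power of a representation as an equivariant bundle. -/
noncomputable def extPower (X : Type) [TopologicalSpace X] [MulAction G X]
    (ρ : G →* Matrix ι ι ℂ) (hρ : Continuous ρ) (k : ℕ) :
    EqBundle G X (Fin k → ι) where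
  rep :=
    { toFun := fun g => tensorMatrix fun _ => ρ g
      map_one' := by simp [tensorMatrix_one]
      map_mul' := fun g h => by simp [tensorMatrix_mul] }
  continuous_rep := continuous_tensorMatrix fun _ => hρ
  proj _ := antisym ι k
  continuous_proj := continuous_const
  idem _ := antisym_idem
  equivariant g _ := commute_antisym fun σ => permTensor_mul_tensorMatrix σ fun _ => ρ g

section Lines

variable {J : Type} [Fintype J] [DecidableEq J] {π : J → Matrix ι ι ℂ}

/-- The tensor product of the members of a family of matrices with indices `a`. -/
def lineTensor (π : J → Matrix ι ι ℂ) (a : Fin k → J) : Matrix (Fin k → ι) (Fin k → ι) ℂ :=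
  tensorMatrix fun i => π (a i)

/-- The sum of the tensor products of members of a family of matrices whose set of indices
is `S`. -/
def blockSum (k : ℕ) (π : J → Matrix ι ι ℂ) (S : Finset J) :
    Matrix (Fin k → ι) (Fin k → ι) ℂ :=
  ∑ b : Fin k → J with Finset.univ.image b = S, lineTensor π b

theorem permTensor_mul_line (a : Fin k → J) :
    permTensor ι σ * lineTensor π a
      = lineTensor π (a ∘ σ.symm) * permTensor ι σ :=
  permTensor_mul_tensorMatrix σ _

theorem line_mul_line (hid : ∀ j, π j * π j = π j) (horth : ∀ i j, i ≠ j → π i * π j = 0)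
    (a b : Fin k → J) :
    lineTensor π a * lineTensor π b
      = if a = b then lineTensor π a else 0 := by
  rw [lineTensor, lineTensor, tensorMatrix_mul]
  split_ifs with h
  · subst h
    simp only [hid]
  · obtain ⟨i, hi⟩ := Function.ne_iff.1 h
    exact tensorMatrix_eq_zero i (horth _ _ hi)

/-- This is v ∧ v = 0: swapping two equal factors of rank one leaves the tensor product unchanged,
while the antisymmetrizer changes sign under the swap. -/
theorem antisym_mul_line_eq_zero (hline : ∀ j, (π j).rank = 1) {a : Fin k → J}
    (ha : ¬ Function.Injective a) : antisym ι k * lineTensor π a = 0 := by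
  obtain ⟨i, j, hij, hne⟩ : ∃ i j, a i = a j ∧ i ≠ j := by
    simpa [Function.Injective] using ha
  have h1 : lineTensor π a * permTensor ι (Equiv.swap i j)
      = lineTensor π a := by
    ext f h
    rw [mul_permTensor_apply, Equiv.symm_swap]
    simp only [lineTensor, tensorMatrix, Matrix.of_apply, Function.comp_apply]
    -- The factors i and j are pulled out of both products. They are entries of one rank-one matrix,
    -- so their column indices may be exchanged.
    rw [← Finset.mul_prod_erase _ _ (Finset.mem_univ i),
      ← Finset.mul_prod_erase _ _ (Finset.mem_erase.2 ⟨hne.symm, Finset.mem_univ j⟩),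
      ← Finset.mul_prod_erase Finset.univ (fun l => π (a l) (f l) (h l)) (Finset.mem_univ i),
      ← Finset.mul_prod_erase (Finset.univ.erase i) (fun l => π (a l) (f l) (h l))
        (Finset.mem_erase.2 ⟨hne.symm, Finset.mem_univ j⟩),
      ← mul_assoc, ← mul_assoc, Equiv.swap_apply_left, Equiv.swap_apply_right, hij,
      rank_one_entries (hline (a j))]
    congr 1
    refine Finset.prod_congr rfl fun l hl => ?_
    simp only [Finset.mem_erase] at hl
    rw [Equiv.swap_apply_of_ne_of_ne hl.2.1 hl.1]
  have h2 : a ∘ (Equiv.swap i j).symm = a := by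
    funext l
    rw [Equiv.symm_swap, Function.comp_apply, Equiv.swap_apply_def]
    split_ifs with h h'
    · rw [h, hij]
    · rw [h', hij]
    · rfl
  have h3 := permTensor_mul_line (π := π) (Equiv.swap i j) a
  rw [h2, h1] at h3
  have h4 : antisym ι k * (permTensor ι (Equiv.swap i j) * lineTensor π a)
      = -(antisym ι k * lineTensor π a) := by
    rw [← mul_assoc, antisym_mul_permTensor, Equiv.Perm.sign_swap hne]
    simp
  rw [h3] at h4
  ext f h
  exact self_eq_neg.1 (congrFun (congrFun h4 f) h)

/-- A permutation σ ≠ 1 moves the injective tuple a to a different one, whose tensor product is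
orthogonal to that of a. Only the identity term of the antisymmetrizer survives. -/
theorem line_mul_antisym_mul_line (hid : ∀ j, π j * π j = π j)
    (horth : ∀ i j, i ≠ j → π i * π j = 0) {a : Fin k → J} (ha : Function.Injective a) :
    lineTensor π a * antisym ι k * lineTensor π a
      = (k.factorial : ℂ)⁻¹ • lineTensor π a := by
  rw [antisym, mul_smul_comm, smul_mul_assoc, Finset.mul_sum, Finset.sum_mul]
  congr 1
  rw [Finset.sum_eq_single 1]
  · rw [permTensor_one]
    simp [line_mul_line hid horth]
  · intro σ _ hσ
    rw [mul_smul_comm, smul_mul_assoc, mul_assoc, permTensor_mul_line, ← mul_assoc,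
      line_mul_line hid horth, if_neg, zero_mul, smul_zero]
    intro h
    apply hσ
    ext i
    have := ha (congrFun h (σ i))
    rw [Equiv.symm_apply_apply] at this
    rw [this]
    rfl
  · simp

theorem sum_sign_smul_permTensor_inv :
    ∑ σ : Equiv.Perm (Fin k), ((σ.sign : ℤ) : ℂ) • permTensor ι σ⁻¹
      = (k.factorial : ℂ) • antisym ι k := by
  rw [antisym, smul_smul, mul_inv_cancel₀ (by exact_mod_cast k.factorial_ne_zero), one_smul]
  exact Fintype.sum_equiv (Equiv.inv _) _ _ fun σ => by simp

/-- Tuples of length k with the same image as an injective one are its rearrangements, each obtained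
from exactly one permutation. -/
theorem sum_image_eq_sum_perm {M : Type*} [AddCommMonoid M] {a : Fin k → J}
    (ha : Function.Injective a) (F : (Fin k → J) → M) :
    ∑ b : Fin k → J with Finset.univ.image b = Finset.univ.image a, F b
      = ∑ σ : Equiv.Perm (Fin k), F (a ∘ σ.symm) := by
  symm
  refine Finset.sum_bij (fun σ _ => a ∘ σ.symm) (fun σ _ => ?_) (fun σ _ τ _ h => ?_)
    (fun b hb => ?_) (fun _ _ => rfl)
  · rw [Finset.mem_filter]
    refine ⟨Finset.mem_univ _, ?_⟩
    ext j
    simp only [Finset.mem_image, Finset.mem_univ, true_and, Function.comp_apply]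
    exact (σ.symm.surjective.exists (p := fun i => a i = j)).symm
  · have : σ.symm = τ.symm := by
      ext i
      rw [ha (congrFun h i)]
    simpa using congrArg Equiv.symm this
  · rw [Finset.mem_filter] at hb
    have hb' := hb.2
    have hinj : Function.Injective b := by
      have : (Finset.univ.image b).card = (Finset.univ : Finset (Fin k)).card := by
        rw [hb', Finset.card_image_of_injective _ ha]
      simpa using Finset.card_image_iff.1 this
    have hex : ∀ i, ∃ l, a l = b i := fun i => by
      have : b i ∈ Finset.univ.image a := hb' ▸ Finset.mem_image_of_mem b (Finset.mem_univ i)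
      simpa using this
    choose f hf using hex
    have hfi : Function.Injective f := fun i j h => hinj (by rw [← hf, ← hf, h])
    refine ⟨(Equiv.ofBijective f (Finite.injective_iff_bijective.1 hfi)).symm,
      Finset.mem_univ _, funext hf⟩

/-- The line tensor of a rearrangement is the conjugate of that of a by σ. The antisymmetrizer turns
the left σ into its sign, and the signed sum of the right factors σ⁻¹ is k! times the
antisymmetrizer. -/
theorem antisym_mul_sum_line {a : Fin k → J} (ha : Function.Injective a) :
    antisym ι k * blockSum k π (Finset.univ.image a)
      = (k.factorial : ℂ) • (antisym ι k * lineTensor π a * antisym ι k) := by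
  rw [blockSum, sum_image_eq_sum_perm ha fun b => lineTensor π b, ← mul_smul_comm,
    ← sum_sign_smul_permTensor_inv, Finset.mul_sum, Finset.mul_sum]
  refine Finset.sum_congr rfl fun σ _ => ?_
  have h : lineTensor π (a ∘ σ.symm)
      = permTensor ι σ * lineTensor π a * permTensor ι σ⁻¹ := by
    rw [permTensor_mul_line, mul_assoc, permTensor_mul, mul_inv_cancel, permTensor_one, mul_one]
  rw [h, mul_smul_comm, ← mul_assoc, ← mul_assoc, antisym_mul_permTensor, smul_mul_assoc,
    smul_mul_assoc]

theorem permTensor_mul_sum_line (S : Finset J) :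
    permTensor ι σ * blockSum k π S = blockSum k π S * permTensor ι σ := by
  rw [blockSum, Finset.mul_sum, Finset.sum_mul]
  refine Finset.sum_equiv (Equiv.arrowCongr σ (Equiv.refl J)) (fun b => ?_) (fun b _ => ?_)
  · simp only [Finset.mem_filter, Finset.mem_univ, true_and]
    have : Finset.univ.image (Equiv.arrowCongr σ (Equiv.refl J) b) = Finset.univ.image b := by
      ext j
      simp only [Finset.mem_image, Finset.mem_univ, true_and]
      exact (σ.symm.surjective.exists (p := fun i => b i = j)).symm
    rw [this]
  · exact permTensor_mul_line σ b

/-- Block sums for different S are orthogonal idempotents, and each commutes with the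
antisymmetrizer because permuting a tuple does not change its image. -/
theorem antisym_mul_blockSum_mul (hid : ∀ j, π j * π j = π j)
    (horth : ∀ i j, i ≠ j → π i * π j = 0) (S T : Finset J) :
    antisym ι k * blockSum k π S * (antisym ι k * blockSum k π T)
      = if S = T then antisym ι k * blockSum k π S else 0 := by
  have hbb : blockSum k π S * blockSum k π T = if S = T then blockSum k π S else 0 := by
    simp only [blockSum, Finset.sum_mul, Finset.mul_sum, line_mul_line hid horth]
    split_ifs with h
    · subst h
      refine Finset.sum_congr rfl fun a ha => ?_
      rw [Finset.sum_ite_eq', if_pos ha]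
    · refine Finset.sum_eq_zero fun a ha => Finset.sum_eq_zero fun b hb => if_neg ?_
      rintro rfl
      exact h ((Finset.mem_filter.1 hb).2.symm.trans (Finset.mem_filter.1 ha).2)
  have hc (S) : antisym ι k * blockSum k π S = blockSum k π S * antisym ι k :=
    commute_antisym fun σ => permTensor_mul_sum_line σ S
  rw [hc S, mul_assoc, ← mul_assoc (antisym ι k), antisym_idem, hc T, ← mul_assoc, hbb]
  split_ifs
  · rfl
  · rw [zero_mul]

theorem sum_antisym_mul_blockSum (hsum : ∑ j, π j = 1) :
    ∑ S ∈ (Finset.univ : Finset J).powerset, antisym ι k * blockSum k π S = antisym ι k := by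
  simp only [blockSum]
  rw [← Finset.mul_sum, Finset.sum_fiberwise_of_maps_to (fun _ _ => by simp)]
  simp only [lineTensor]
  rw [sum_tensorMatrix, hsum, tensorMatrix_one, mul_one]

theorem antisym_mul_blockSum_eq_zero (hline : ∀ j, (π j).rank = 1) {S : Finset J}
    (hS : S.card ≠ k) : antisym ι k * blockSum k π S = 0 := by
  rw [blockSum, Finset.mul_sum]
  refine Finset.sum_eq_zero fun b hb => antisym_mul_line_eq_zero hline fun hinj => hS ?_
  rw [← (Finset.mem_filter.1 hb).2, Finset.card_image_of_injective _ hinj]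
  simp

end Lines

section Lines

variable {J : Type} [Fintype J] [DecidableEq J] {ρ : G →* Matrix ι ι ℂ} (hρ : Continuous ρ)
  (L : J → EqBundle G X ι)

theorem antisym_mul_extPower_rep (g : G) : antisym ι k * (extPower X ρ hρ k).rep g
    = (extPower X ρ hρ k).rep g * antisym ι k :=
  commute_antisym fun σ => permTensor_mul_tensorMatrix σ fun _ => ρ g

variable {L}

theorem lineTensor_mul_extPower_rep (hrep : ∀ j, (L j).rep = ρ) (a : Fin k → J) (g : G) (x : X) :
    lineTensor (fun j => (L j).proj (g • x)) a * (extPower X ρ hρ k).rep g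
      = (extPower X ρ hρ k).rep g * lineTensor (fun j => (L j).proj x) a := by
  have := (EqBundle.tensorFamily fun i => L (a i)).equivariant g x
  simp only [EqBundle.tensorFamily, hrep] at this
  exact this

/-- The summand of an exterior power of a sum of line bundles with weights in `S`. -/
noncomputable def extBlock (k : ℕ) (hrep : ∀ j, (L j).rep = ρ)
    (horth : ∀ x i j, i ≠ j → (L i).proj x * (L j).proj x = 0) (S : Finset J) :
    EqBundle G X (Fin k → ι) :=
  (extPower X ρ hρ k).cut (fun x => antisym ι k * blockSum k (fun j => (L j).proj x) S)
    (continuous_const.matrix_mul (continuous_finsetSum _ fun a _ =>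
      continuous_tensorMatrix fun i => (L (a i)).continuous_proj))
    (fun x => (antisym_mul_blockSum_mul (fun j => (L j).idem x) (horth x) S S).trans (if_pos rfl))
    (fun g x => by
      rw [← mul_assoc, ← antisym_mul_extPower_rep, mul_assoc, mul_assoc]
      congr 1
      simp only [blockSum, Finset.sum_mul, Finset.mul_sum, lineTensor_mul_extPower_rep hρ hrep])

theorem bcls_extPower_eq_sum_extBlock (hrep : ∀ j, (L j).rep = ρ)
    (hsum : ∀ x, ∑ j, (L j).proj x = 1)
    (horth : ∀ x i j, i ≠ j → (L i).proj x * (L j).proj x = 0) :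
    bcls (extPower X ρ hρ k)
      = ∑ S ∈ (Finset.univ : Finset J).powerset, bcls (extBlock hρ k hrep horth S) :=
  bcls_finset_sum _ _ _ (fun _ _ => rfl) (fun x => (sum_antisym_mul_blockSum (hsum x)).symm)
    fun S _ T _ h x => (antisym_mul_blockSum_mul (fun j => (L j).idem x) (horth x) S T).trans
      (if_neg h)

/-- Let A be the antisymmetrizer and P the line tensor of a. The block is the image of k!·APA, and
k!·PAP = P, so PA and k!·AP induce inverse isomorphisms. -/
theorem extBlock_iso (hrep : ∀ j, (L j).rep = ρ)
    (horth : ∀ x i j, i ≠ j → (L i).proj x * (L j).proj x = 0) {a : Fin k → J}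
    (ha : Function.Injective a) :
    (extBlock hρ k hrep horth (Finset.univ.image a)).Iso
      (EqBundle.tensorFamily fun i => L (a i)) := by
  have hk : (k.factorial : ℂ) ≠ 0 := by exact_mod_cast k.factorial_ne_zero
  have hrep' : (EqBundle.tensorFamily fun i => L (a i)).rep = (extPower X ρ hρ k).rep := by
    ext1 g
    simp only [EqBundle.tensorFamily, hrep]
    rfl
  have hcl : Continuous fun x => lineTensor (fun j => (L j).proj x) a :=
    (EqBundle.tensorFamily fun i => L (a i)).continuous_proj
  have hll (x) : lineTensor (fun j => (L j).proj x) a * lineTensor (fun j => (L j).proj x) a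
      = lineTensor (fun j => (L j).proj x) a := by
    rw [line_mul_line (fun j => (L j).idem x) (horth x), if_pos rfl]
  have hcs : Continuous fun x => (k.factorial : ℂ) •
      (antisym ι k * lineTensor (fun j => (L j).proj x) a) := by
    refine continuous_matrix fun f h => ?_
    exact continuous_const.mul ((continuous_const.matrix_mul hcl).matrix_elem f h)
  refine ⟨fun x => lineTensor (fun j => (L j).proj x) a * antisym ι k,
    fun x => (k.factorial : ℂ) • (antisym ι k * lineTensor (fun j => (L j).proj x) a),
    hcl.matrix_mul continuous_const,
    hcs, fun g x => ?_, fun g x => ?_, fun x => ?_,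
    fun x => ?_⟩
  · rw [hrep']
    simp only [extBlock, EqBundle.cut_rep]
    rw [mul_assoc, antisym_mul_extPower_rep, ← mul_assoc, lineTensor_mul_extPower_rep hρ hrep,
      mul_assoc]
  · rw [hrep']
    simp only [extBlock, EqBundle.cut_rep]
    rw [smul_mul_assoc, mul_smul_comm, mul_assoc, lineTensor_mul_extPower_rep hρ hrep,
      ← mul_assoc, antisym_mul_extPower_rep, mul_assoc]
  · simp only [extBlock, EqBundle.cut_proj]
    rw [antisym_mul_sum_line ha, smul_mul_assoc, mul_assoc, ← mul_assoc (lineTensor _ _), hll,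
      mul_assoc]
  · change _ = lineTensor (fun j => (L j).proj x) a
    rw [mul_smul_comm, mul_assoc, ← mul_assoc (antisym ι k), antisym_idem, ← mul_assoc,
      line_mul_antisym_mul_line (fun j => (L j).idem x) (horth x) ha, smul_smul,
      mul_inv_cancel₀ hk, one_smul]

end Lines

/-- The class of the exterior power of a sum of line bundles is the elementary symmetric function
of their classes. -/
theorem bcls_extPower {J : Type} [Fintype J] [LinearOrder J]
    {ρ : G →* Matrix ι ι ℂ} (hρ : Continuous ρ) {L : J → EqBundle G X ι}
    (hrep : ∀ j, (L j).rep = ρ) (hsum : ∀ x, ∑ j, (L j).proj x = 1)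
    (horth : ∀ x i j, i ≠ j → (L i).proj x * (L j).proj x = 0)
    (hline : ∀ x j, ((L j).proj x).rank = 1) (k : ℕ) :
    bcls (extPower X ρ hρ k)
      = ∑ S ∈ Finset.powersetCard k (Finset.univ : Finset J), ∏ j ∈ S, bcls (L j) := by
  rw [bcls_extPower_eq_sum_extBlock hρ hrep hsum horth]
  refine (Finset.sum_subset (fun S hS => by simp) fun S _ hS => ?_).symm.trans
    (Finset.sum_congr rfl fun S hS => ?_)
  -- If S does not have k elements, every k-tuple with image S repeats an index, so the block is
  -- zero.
  · refine bcls_eq_zero fun x => antisym_mul_blockSum_eq_zero (hline x) fun h => hS ?_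
    simpa using h
  · have hcard := (Finset.mem_powersetCard.1 hS).2
    -- The increasing enumeration of S serves as the injective tuple; the order on J has no other
    -- role.
    have ha := (S.orderEmbOfFin hcard).injective
    have haS := S.image_orderEmbOfFin_univ hcard
    have h := bcls_eq_of_iso (extBlock_iso hρ hrep horth ha)
    rw [haS] at h
    rw [h, bcls_tensorFamily]
    nth_rw 2 [← haS]
    rw [Finset.prod_image ha.injOn]

end ExteriorPowers

/-! ### Characters of representations and their linear independence. -/

section Characters

variable {T : Type} [Group T] [TopologicalSpace T]
variable {ι κ : Type} [Fintype ι] [DecidableEq ι] [Fintype κ] [DecidableEq κ]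

/-- The character of a bundle over a point. -/
noncomputable def EqBundle.char (E : EqBundle T PUnit ι) (t : T) : ℂ :=
  (E.rep t * E.proj PUnit.unit).trace

theorem EqBundle.Iso.char_eq {E : EqBundle T PUnit ι} {F : EqBundle T PUnit κ} (h : E.Iso F) :
    E.char = F.char := by
  obtain ⟨u, v, -, -, h1, -, h3, h4⟩ := h
  funext t
  have h1 : u PUnit.unit * E.rep t = F.rep t * u PUnit.unit := h1 t PUnit.unit
  rw [EqBundle.char, EqBundle.char, ← h3, ← h4, ← Matrix.mul_assoc, ← Matrix.mul_assoc, ← h1,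
    Matrix.trace_mul_comm (E.rep t * v PUnit.unit), ← Matrix.mul_assoc]

theorem EqBundle.char_reindex (e : ι ≃ κ) (E : EqBundle T PUnit ι) :
    (E.reindex e).char = E.char := (EqBundle.iso_reindex e E).char_eq.symm

variable (T) in
/-- The character homomorphism on the representation ring. -/
noncomputable def charHom : KRing T PUnit →+* (T → ℂ) :=
  Ideal.Quotient.lift (kIdeal T PUnit)
    (MvPolynomial.eval₂Hom (Int.castRingHom (T → ℂ)) (fun E => E.2.char)) (by
    intro a ha
    refine (Ideal.span_le.2 ?_ : kIdeal T PUnit ≤ RingHom.ker _) ha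
    rintro _ ⟨a, b, h, rfl⟩
    change MvPolynomial.eval₂Hom _ _ (a - b) = 0
    rw [map_sub, sub_eq_zero]
    cases h with
    | iso E F h =>
      simp only [gen, MvPolynomial.coe_eval₂Hom, MvPolynomial.eval₂_X]
      exact h.char_eq
    | add E F =>
      simp only [gen, map_add, MvPolynomial.coe_eval₂Hom, MvPolynomial.eval₂_X,
        EqBundle.char_reindex]
      funext t
      simp [EqBundle.char, EqBundle.directSum, Matrix.fromBlocks_multiply, Matrix.trace]
    | mul E F =>
      simp only [gen, map_mul, MvPolynomial.coe_eval₂Hom, MvPolynomial.eval₂_X,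
        EqBundle.char_reindex]
      funext t
      refine (congrArg Matrix.trace (Matrix.mul_kronecker_mul _ _ _ _).symm).trans ?_
      exact Matrix.trace_kronecker _ _
    | one =>
      simp only [gen, map_one, MvPolynomial.coe_eval₂Hom, MvPolynomial.eval₂_X]
      funext t
      simp [EqBundle.char, EqBundle.trivialLine])

theorem charHom_bcls (E : EqBundle T PUnit ι) : charHom T (bcls E) = E.char := by
  refine (Ideal.Quotient.lift_mk _ _ _).trans ?_
  simp only [gen, MvPolynomial.coe_eval₂Hom, MvPolynomial.eval₂_X]
  exact EqBundle.char_reindex _ E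

/-- The one-dimensional representation defined by a continuous character. -/
noncomputable def charBundle (χ : T →ₜ* ℂˣ) : EqBundle T PUnit (Fin 1) where
  rep := (Matrix.scalar (Fin 1)).toMonoidHom.comp ((Units.coeHom ℂ).comp χ.toMonoidHom)
  continuous_rep := Continuous.matrix_diagonal
    (continuous_pi fun _ => Units.continuous_val.comp χ.continuous_toFun)
  proj _ := 1
  continuous_proj := continuous_const
  idem _ := by simp
  equivariant _ _ := by simp

theorem charBundle_rep (χ : T →ₜ* ℂˣ) (t : T) :
    (charBundle χ).rep t = Matrix.scalar (Fin 1) (χ t : ℂ) := rfl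

theorem char_charBundle (χ : T →ₜ* ℂˣ) (t : T) : (charBundle χ).char t = χ t := by
  rw [EqBundle.char, charBundle_rep]
  simp [charBundle]

variable (T) in
/-- A continuous character, as an element of the representation ring. -/
noncomputable def charClass : (T →ₜ* ℂˣ) →* KRing T PUnit where
  toFun χ := bcls (charBundle χ)
  map_one' := by
    refine Eq.trans ?_ ((mk_eq_of_rel (KRel.one (G := T) (X := PUnit))).trans (map_one _))
    change _ = cls _
    rw [← bcls_eq_cls]
    congr 1
  map_mul' χ ψ := by
    rw [← bcls_tensor]
    refine bcls_eq_of_iso ⟨fun _ => Matrix.of fun _ _ => 1, fun _ => Matrix.of fun _ _ => 1,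
      continuous_const, continuous_const, ?_, ?_, ?_, ?_⟩ <;> intros <;> ext i j <;>
      simp [Matrix.mul_apply, EqBundle.tensor, charBundle, Matrix.one_apply,
        eq_iff_true_of_subsingleton, Matrix.kronecker, Matrix.diagonal_apply]

theorem charHom_charClass (χ : T →ₜ* ℂˣ) (t : T) : charHom T (charClass T χ) t = χ t := by
  change charHom T (bcls (charBundle χ)) t = _
  rw [charHom_bcls, char_charBundle]

/-- Distinct continuous characters are linearly independent. -/
theorem charHom_lift_injective :
    Function.Injective fun a : MonoidAlgebra ℤ (T →ₜ* ℂˣ) =>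
      charHom T (MonoidAlgebra.lift ℤ _ (T →ₜ* ℂˣ) (charClass T) a) := by
  -- Dedekind's independence of characters over ℂ, weakened to integer coefficients.
  have hli : LinearIndependent ℤ
      (fun χ : T →ₜ* ℂˣ => ((((Units.coeHom ℂ).comp χ.toMonoidHom : T →* ℂ)) : T → ℂ)) :=
    ((linearIndependent_monoidHom T ℂ).comp
      (fun χ : T →ₜ* ℂˣ => ((Units.coeHom ℂ).comp χ.toMonoidHom : T →* ℂ)) (by
        intro χ ψ h
        ext t
        exact DFunLike.congr_fun h t)).restrict_scalars' ℤ
  intro a b h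
  refine MonoidAlgebra.coeff_injective (hli ?_)
  have key (a : MonoidAlgebra ℤ (T →ₜ* ℂˣ)) :
      charHom T (MonoidAlgebra.lift ℤ _ (T →ₜ* ℂˣ) (charClass T) a)
        = Finsupp.linearCombination ℤ (fun χ : T →ₜ* ℂˣ =>
          ((((Units.coeHom ℂ).comp χ.toMonoidHom : T →* ℂ)) : T → ℂ)) a.coeff := by
    rw [MonoidAlgebra.lift_apply, Finsupp.linearCombination_apply, Finsupp.sum, Finsupp.sum,
      map_sum]
    refine Finset.sum_congr rfl fun χ _ => ?_
    rw [map_zsmul]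
    congr 1
    funext t
    exact charHom_charClass χ t
  rw [← key, ← key]
  exact h

end Characters

/-! ### Representation rings of commutative groups with dense torsion. -/

section Diagonalizable

variable {T : Type} [CommGroup T] [TopologicalSpace T]
variable {ι : Type} [Fintype ι] [DecidableEq ι]

theorem eq_zero_of_rank_eq_zero {e : Matrix ι ι ℂ} (h : e.rank = 0) : e = 0 := by
  rw [Matrix.rank, Submodule.finrank_eq_zero, LinearMap.range_eq_bot] at h
  exact Matrix.toLin'.injective (h.trans (map_zero _).symm)

theorem rank_sub_lt {e f : Matrix ι ι ℂ} (he : e * e = e) (hf : f * f = f) (hef : e * f = f)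
    (hfe : f * e = f) (h0 : f ≠ 0) : (e - f).rank < e.rank := by
  have h1 : (e - f) * (e - f) = e - f := by
    rw [sub_mul, mul_sub, mul_sub, he, hf, hef, hfe]; simp
  have h := Matrix.trace_sub e f
  rw [trace_eq_rank h1, trace_eq_rank he, trace_eq_rank hf] at h
  have h' : ((e - f).rank : ℂ) + f.rank = e.rank := by rw [h]; ring
  have h'' : (e - f).rank + f.rank = e.rank := by exact_mod_cast h'
  have : f.rank ≠ 0 := mt eq_zero_of_rank_eq_zero h0
  omega

/-- An element of finite order splits off a nontrivial idempotent from every idempotent on which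
it does not act by a scalar. -/
theorem exists_idempotent_of_pow_eq_one {A e : Matrix ι ι ℂ} {n : ℕ} (hn : n ≠ 0)
    (hA : A ^ n = 1) (hAe : Commute A e) (he : e * e = e) (hne : ∀ c : ℂ, A * e ≠ c • e) :
    ∃ f : Matrix ι ι ℂ, f * f = f ∧ e * f = f ∧ f * e = f ∧ f ≠ 0 ∧ f ≠ e ∧
      ∀ B, Commute B A → Commute B e → Commute B f := by
  have hn' : (n : ℂ) ≠ 0 := by exact_mod_cast hn
  obtain ⟨ω, hω⟩ : ∃ ω : ℂ, IsPrimitiveRoot ω n := ⟨_, Complex.isPrimitiveRoot_exp n hn⟩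
  -- `S a` is n times the projection onto the eigenspace of A with eigenvalue ω^{-a}; `f a` below is
  -- the part of that projection inside the image of e.
  let S : ℕ → Matrix ι ι ℂ := fun a => ∑ k ∈ Finset.range n, (ω ^ a • A) ^ k
  have hS : ∑ a ∈ Finset.range n, S a = (n : ℂ) • 1 := by
    simp only [S, smul_pow]
    rw [Finset.sum_comm, Finset.sum_eq_single 0]
    · simp [← Nat.cast_smul_eq_nsmul ℂ]
    · intro k hk hk0
      rw [← Finset.sum_smul]
      have h1 : ω ^ k - 1 ≠ 0 :=
        sub_ne_zero.2 (hω.pow_ne_one_of_pos_of_lt hk0 (Finset.mem_range.1 hk))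
      have h2 := mul_geom_sum (ω ^ k) n
      rw [← pow_mul, mul_comm k, pow_mul, hω.pow_eq_one, one_pow, sub_self] at h2
      have h3 := (mul_eq_zero.1 h2).resolve_left h1
      simp only [← pow_mul, mul_comm k] at h3
      simp only [← pow_mul]
      rw [h3, zero_smul]
    · intro h
      exact absurd (Finset.mem_range.2 (Nat.pos_of_ne_zero hn)) h
  have hBS (a) : (ω ^ a • A) * S a = S a := by
    have h := mul_geom_sum (ω ^ a • A) n
    rw [smul_pow, hA, ← pow_mul, mul_comm a, pow_mul, hω.pow_eq_one, one_pow, one_smul,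
      sub_self, sub_mul, one_mul, sub_eq_zero] at h
    exact h
  have hSS (a) : S a * S a = (n : ℂ) • S a := by
    have (k : ℕ) : (ω ^ a • A) ^ k * S a = S a := by
      induction k with
      | zero => simp
      | succ k ih => rw [pow_succ, mul_assoc, hBS, ih]
    conv_lhs => enter [1]; simp only [S]
    rw [Finset.sum_mul, Finset.sum_congr rfl fun k _ => this k]
    simp [← Nat.cast_smul_eq_nsmul ℂ]
  have hcomm (a) {B : Matrix ι ι ℂ} (hB : Commute B A) : Commute B (S a) :=
    Commute.sum_right _ _ _ fun k _ => (hB.smul_right _).pow_right _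
  let f : ℕ → Matrix ι ι ℂ := fun a => (n : ℂ)⁻¹ • (S a * e)
  have hSe (a) : S a * e = e * S a := (hcomm a hAe.symm).symm
  have hff (a) : f a * f a = f a := by
    simp only [f, smul_mul_assoc, mul_smul_comm]
    rw [mul_assoc, ← mul_assoc e, ← hSe, mul_assoc, he, ← mul_assoc, hSS, smul_mul_assoc,
      smul_smul (n : ℂ)⁻¹ n, inv_mul_cancel₀ hn', one_smul]
  have hef (a) : e * f a = f a := by
    simp only [f, mul_smul_comm]
    rw [hSe, ← mul_assoc, he]
  have hfe (a) : f a * e = f a := by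
    simp only [f, smul_mul_assoc]
    rw [mul_assoc, he]
  have hsum : ∑ a ∈ Finset.range n, f a = e := by
    simp only [f]
    rw [← Finset.smul_sum, ← Finset.sum_mul, hS, smul_mul_assoc, one_mul, smul_smul,
      inv_mul_cancel₀ hn', one_smul]
  -- The `f a` sum to e ≠ 0, so one of them is nonzero. It cannot be all of e, since A would then
  -- act on the image of e by the scalar ω^{-a}.
  obtain ⟨a, -, ha⟩ : ∃ a ∈ Finset.range n, f a ≠ 0 := by
    refine Finset.exists_ne_zero_of_sum_ne_zero (hsum.trans_ne ?_)
    rintro rfl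
    exact hne 0 (by simp)
  refine ⟨f a, hff a, hef a, hfe a, ha, fun h => hne (ω ^ a)⁻¹ ?_, fun B hB hB' =>
    ((hcomm a hB).mul_right hB').smul_right _⟩
  have hωa : ω ^ a ≠ 0 := pow_ne_zero _ (hω.ne_zero hn)
  have h2 : (ω ^ a • A) * f a = f a := by
    simp only [f, mul_smul_comm]
    rw [← mul_assoc, hBS]
  rw [h] at h2
  nth_rw 2 [← h2]
  rw [smul_mul_assoc, smul_smul, inv_mul_cancel₀ hωa, one_smul]

/-- A bundle over a point on which the group acts by scalars contains the corresponding
character. -/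
theorem exists_charBundle_iso_cut {E : EqBundle T PUnit ι} (h0 : E.proj PUnit.unit ≠ 0)
    (hs : ∀ t, ∃ c : ℂ, E.rep t * E.proj PUnit.unit = c • E.proj PUnit.unit) :
    ∃ (χ : T →ₜ* ℂˣ) (F : EqBundle T PUnit ι), F.rep = E.rep ∧ F.Iso (charBundle χ) ∧
      E.proj PUnit.unit * F.proj PUnit.unit = F.proj PUnit.unit ∧
      F.proj PUnit.unit * E.proj PUnit.unit = F.proj PUnit.unit ∧ F.proj PUnit.unit ≠ 0 := by
  set e := E.proj PUnit.unit with he_def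
  have he : e * e = e := E.idem _
  obtain ⟨i₀, j₀, hij⟩ : ∃ i j, e i j ≠ 0 := by
    by_contra! h
    exact h0 (Matrix.ext h)
  choose c hc using hs
  have hcs (a b : ℂ) (h : a • e = b • e) : a = b := smul_left_injective ℂ h0 h
  have hc1 : c 1 = 1 := hcs _ _ (by rw [← hc, map_one, one_mul, one_smul])
  have hcm (s t) : c (s * t) = c s * c t := hcs _ _ (by
    rw [← hc, map_mul, mul_assoc, hc, mul_smul_comm, hc, smul_smul, mul_comm])
  have hcc : Continuous c := by
    have h (t) : c t = (E.rep t * e) i₀ j₀ * (e i₀ j₀)⁻¹ := by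
      rw [hc, Matrix.smul_apply, smul_eq_mul, mul_inv_cancel_right₀ hij]
    rw [funext h]
    exact ((E.continuous_rep.matrix_mul continuous_const).matrix_elem _ _).mul continuous_const
  have hc0 (t) : c t ≠ 0 := fun h => by
    have := hcm t t⁻¹
    rw [mul_inv_cancel, h, zero_mul, hc1] at this
    exact one_ne_zero this
  have hci (t) : (c t)⁻¹ = c t⁻¹ :=
    inv_eq_of_mul_eq_one_right (by rw [← hcm, mul_inv_cancel, hc1])
  let χ : T →ₜ* ℂˣ :=
    { toFun := MonoidHom.toHomUnits ⟨⟨c, hc1⟩, hcm⟩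
      map_one' := map_one _
      map_mul' := map_mul _
      continuous_toFun := Units.continuous_iff.2 ⟨hcc, by
        have h (t) : ((MonoidHom.toHomUnits ⟨⟨c, hc1⟩, hcm⟩ t)⁻¹ : ℂˣ).val = c t⁻¹ := by
          rw [← map_inv]; rfl
        simp only [h, ← hci]
        exact hcc.inv₀ hc0⟩ }
  have hχ (t) : (χ t : ℂ) = c t := rfl
  have her (t) : e * E.rep t = c t • e := by
    rw [← hc]
    exact E.equivariant t PUnit.unit
  -- The column and the normalized row of e through a nonzero entry satisfy uv = 1, so vu is an
  -- idempotent of rank one below e. Scalar action makes it invariant.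
  let v : Matrix ι (Fin 1) ℂ := Matrix.of fun i _ => e i j₀
  let u : Matrix (Fin 1) ι ℂ := Matrix.of fun _ j => (e i₀ j₀)⁻¹ * e i₀ j
  have huv : u * v = 1 := by
    ext i j
    have := congrFun (congrFun he i₀) j₀
    rw [Matrix.mul_apply] at this
    simp only [u, v, Matrix.mul_apply, Matrix.of_apply, mul_assoc]
    rw [← Finset.mul_sum, this, inv_mul_cancel₀ hij, Subsingleton.elim i j, Matrix.one_apply_eq]
  have hev : e * v = v := by
    ext i j
    exact congrFun (congrFun he i) j₀
  have hue : u * e = u := by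
    ext i j
    have := congrFun (congrFun he i₀) j
    rw [Matrix.mul_apply] at this
    simp only [u, Matrix.mul_apply, Matrix.of_apply, mul_assoc]
    rw [← Finset.mul_sum, this]
  have hrv (t) : E.rep t * v = c t • v := by
    rw [← hev, ← Matrix.mul_assoc, hc, Matrix.smul_mul]
  have hur (t) : u * E.rep t = c t • u := by
    rw [← hue, Matrix.mul_assoc, her, Matrix.mul_smul]
  have hid : v * u * (v * u) = v * u := by
    rw [Matrix.mul_assoc, ← Matrix.mul_assoc u, huv, Matrix.one_mul]
  refine ⟨χ, E.cut (fun _ => v * u) continuous_const (fun _ => hid) (fun t _ => ?_), rfl,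
    ⟨fun _ => u, fun _ => v, continuous_const, continuous_const, fun t _ => ?_, fun t _ => ?_,
      fun _ => rfl, fun _ => huv⟩, ?_, ?_, fun h => ?_⟩
  · rw [Matrix.mul_assoc, hur, ← Matrix.mul_assoc, hrv, Matrix.smul_mul, Matrix.mul_smul]
  · rw [charBundle_rep, hχ]
    simp [hur, Matrix.smul_eq_diagonal_mul]
  · rw [charBundle_rep, hχ]
    simp [hrv, Matrix.smul_eq_mul_diagonal]
  · rw [EqBundle.cut_proj, ← Matrix.mul_assoc, hev]
  · rw [EqBundle.cut_proj, Matrix.mul_assoc, hue]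
  · have : u * (v * u) * v = 1 := by rw [← Matrix.mul_assoc, huv, Matrix.one_mul, huv]
    rw [EqBundle.cut_proj] at h
    rw [h] at this
    simp at this

/-- Simultaneous diagonalization by induction on the rank, with no averaging over the group. A
torsion element that is not scalar on the fibre has spectral projections, which commute with the
commutative group and split the bundle. If all torsion elements are scalar, then by density so is
every element, and a character splits off. -/
theorem bcls_mem_closure_range_charClass (hT : Dense {t : T | IsOfFinOrder t})
    (E : EqBundle T PUnit ι) :
    bcls E ∈ AddSubmonoid.closure (Set.range (charClass T)) := by
  induction hr : (E.proj PUnit.unit).rank using Nat.strong_induction_on generalizing E with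
  | _ m ih =>
  subst hr
  have split (f : Matrix ι ι ℂ) (hf : f * f = f) (hef : E.proj PUnit.unit * f = f)
      (hfe : f * E.proj PUnit.unit = f) (h : ∀ t, f * E.rep t = E.rep t * f) (hf0 : f ≠ 0) :
      ∃ F F' : EqBundle T PUnit ι, F.rep = E.rep ∧ F.proj = (fun _ => f) ∧
        bcls E = bcls F + bcls F' ∧ bcls F' ∈ AddSubmonoid.closure (Set.range (charClass T)) := by
    let F := E.cut (fun _ => f) continuous_const (fun _ => hf) (fun t _ => h t)
    have he := E.idem PUnit.unit
    let F' := E.cut (fun _ => E.proj PUnit.unit - f) continuous_const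
      (fun _ => by rw [sub_mul, mul_sub, mul_sub, he, hf, hef, hfe]; simp)
      (fun t _ => by rw [sub_mul, mul_sub, h, ← E.equivariant t PUnit.unit])
    refine ⟨F, F', rfl, rfl, bcls_add rfl rfl (fun x => ?_) (fun x => ?_) (fun x => ?_),
      ih _ (rank_sub_lt he hf hef hfe hf0) F' rfl⟩
    · simp [F, F']
    · simp [F, F', mul_sub, hfe, hf]
    · simp [F, F', sub_mul, hef, hf]
  have he := E.idem PUnit.unit
  by_cases h0 : E.proj PUnit.unit = 0
  · rw [bcls_eq_zero fun _ => h0]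
    exact zero_mem _
  have htr : (E.proj PUnit.unit).trace ≠ 0 := by
    rw [trace_eq_rank he]
    exact_mod_cast mt eq_zero_of_rank_eq_zero h0
  by_cases hs : ∀ t, IsOfFinOrder t → ∃ c : ℂ, E.rep t * E.proj PUnit.unit = c • E.proj PUnit.unit
  · have hs' : ∀ t, ∃ c : ℂ, E.rep t * E.proj PUnit.unit = c • E.proj PUnit.unit := by
      -- Being scalar on the image of e is expressed as tr(e)·ρ(t)e = tr(ρ(t)e)·e. Both sides are
      -- continuous in t, so the equality extends from the dense set of torsion elements.
      let φ : T → Matrix ι ι ℂ := fun t => (E.proj PUnit.unit).trace • (E.rep t * E.proj PUnit.unit)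
      let ψ : T → Matrix ι ι ℂ := fun t => (E.rep t * E.proj PUnit.unit).trace • E.proj PUnit.unit
      have h1 : Continuous fun t => E.rep t * E.proj PUnit.unit :=
        E.continuous_rep.matrix_mul continuous_const
      have hφ : Continuous φ :=
        continuous_matrix fun i j => continuous_const.mul (h1.matrix_elem i j)
      have hψ : Continuous ψ :=
        continuous_matrix fun i j => h1.matrix_trace.mul continuous_const
      have : φ = ψ := Continuous.ext_on hT hφ hψ fun t ht => by
        obtain ⟨c, hc⟩ := hs t ht
        simp only [φ, ψ, hc, Matrix.trace_smul, smul_smul, smul_eq_mul, mul_comm]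
      intro t
      refine ⟨(E.proj PUnit.unit).trace⁻¹ * (E.rep t * E.proj PUnit.unit).trace, ?_⟩
      have := congrFun this t
      simp only [φ, ψ] at this
      rw [mul_smul, ← this, smul_smul, inv_mul_cancel₀ htr, one_smul]
    obtain ⟨χ, F, hF, hiso, h1, h2, h3⟩ := exists_charBundle_iso_cut h0 hs'
    obtain ⟨F₁, F₂, hF₁, hp, hadd, hmem⟩ := split _ (F.idem _) h1 h2
      (fun t => by rw [← hF]; exact F.equivariant t PUnit.unit) h3
    have : F₁ = F := EqBundle.ext_rep_proj (hF₁.trans hF.symm) hp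
    rw [hadd, this, bcls_eq_of_iso hiso]
    exact add_mem (AddSubmonoid.subset_closure ⟨χ, rfl⟩) hmem
  · push Not at hs
    obtain ⟨t, ht, hc⟩ := hs
    obtain ⟨n, hn, htn⟩ := isOfFinOrder_iff_pow_eq_one.1 ht
    obtain ⟨f, hf, hef, hfe, hf0, hf1, hcomm⟩ := exists_idempotent_of_pow_eq_one hn.ne'
      (by rw [← map_pow, htn, map_one]) (E.equivariant t PUnit.unit).symm he hc
    obtain ⟨F₁, F₂, hF₁, hp, hadd, hmem⟩ := split f hf hef hfe (fun s =>
      ((hcomm (E.rep s) (by rw [Commute, SemiconjBy, ← map_mul, ← map_mul, mul_comm])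
        (E.equivariant s PUnit.unit).symm)).symm) hf0
    rw [hadd]
    refine add_mem (ih _ ?_ F₁ rfl) hmem
    rw [hp]
    have := rank_sub_lt he (f := E.proj PUnit.unit - f)
      (by rw [sub_mul, mul_sub, mul_sub, he, hf, hef, hfe]; simp)
      (by rw [mul_sub, he, hef]) (by rw [sub_mul, he, hfe]) (sub_ne_zero.2 hf1.symm)
    simpa using this

theorem charClass_lift_surjective (hT : Dense {t : T | IsOfFinOrder t}) :
    Function.Surjective (MonoidAlgebra.lift ℤ (KRing T PUnit) (T →ₜ* ℂˣ) (charClass T)) := by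
  suffices h : ∀ a : FreeBundleRing T PUnit,
      kMk T PUnit a ∈ (MonoidAlgebra.lift ℤ (KRing T PUnit) (T →ₜ* ℂˣ) (charClass T)).range by
    intro x
    obtain ⟨a, rfl⟩ := Ideal.Quotient.mk_surjective x
    exact h a
  intro a
  induction a using MvPolynomial.induction_on with
  | C n =>
    have : kMk T PUnit (MvPolynomial.C n) = (n : KRing T PUnit) := by
      rw [← map_intCast (kMk T PUnit)]; rfl
    rw [this]
    exact intCast_mem _ n
  | add p q hp hq => rw [map_add]; exact add_mem hp hq
  | mul_X p E hp =>
    rw [map_mul]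
    refine mul_mem hp ?_
    change cls E.2 ∈ _
    rw [← bcls_eq_cls]
    have hle : AddSubmonoid.closure (Set.range (charClass T)) ≤
        (MonoidAlgebra.lift ℤ (KRing T PUnit) (T →ₜ* ℂˣ)
          (charClass T)).range.toSubring.toAddSubgroup.toAddSubmonoid := by
      refine AddSubmonoid.closure_le.2 ?_
      rintro _ ⟨χ, rfl⟩
      exact ⟨MonoidAlgebra.of ℤ _ χ, MonoidAlgebra.lift_of _ _⟩
    exact hle (bcls_mem_closure_range_charClass hT E.2)

theorem charHom_injective (hT : Dense {t : T | IsOfFinOrder t}) :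
    Function.Injective (charHom T) := by
  intro x y h
  obtain ⟨a, rfl⟩ := charClass_lift_surjective hT x
  obtain ⟨b, rfl⟩ := charClass_lift_surjective hT y
  rw [charHom_lift_injective h]

/-- Two finite sets generate a finitely generated torsion-free subgroup, and a product unique there
is unique in M. -/
theorem uniqueProds_of_isMulTorsionFree (M : Type*) [CommGroup M] [IsMulTorsionFree M] :
    UniqueProds M where
  uniqueMul_of_nonempty {A B} hA hB := by
    classical
    let H : Subgroup M := Subgroup.closure (A ∪ B : Finset M)
    have hfg : Group.FG H := (Group.fg_iff_subgroup_fg H).2 ⟨_, rfl⟩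
    have : Monoid.FG H := Group.fg_iff_monoid_fg.1 hfg
    have : IsMulTorsionFree H := Subtype.val_injective.isMulTorsionFree H.subtype
    have hU : UniqueProds H := inferInstance
    let A' : Finset H := A.subtype (· ∈ H)
    let B' : Finset H := B.subtype (· ∈ H)
    have hmA (a) (ha : a ∈ A) : a ∈ H := Subgroup.subset_closure (by simp [ha])
    have hmB (a) (ha : a ∈ B) : a ∈ H := Subgroup.subset_closure (by simp [ha])
    obtain ⟨a, ha⟩ := hA
    obtain ⟨b, hb⟩ := hB
    obtain ⟨a₀, ha₀, b₀, hb₀, hu⟩ := hU.uniqueMul_of_nonempty (A := A') (B := B')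
      ⟨⟨a, hmA a ha⟩, by simpa [A'] using ha⟩ ⟨⟨b, hmB b hb⟩, by simpa [B'] using hb⟩
    refine ⟨a₀, by simpa [A'] using ha₀, b₀, by simpa [B'] using hb₀, fun a b ha hb h => ?_⟩
    have := hu (a := ⟨a, hmA a ha⟩) (b := ⟨b, hmB b hb⟩) (by simpa [A'] using ha)
      (by simpa [B'] using hb) (Subtype.ext h)
    simpa [Subtype.ext_iff] using this

/-- The representation ring of a divisible commutative group with dense torsion is a domain. -/
theorem isDomain_repRing (hT : Dense {t : T | IsOfFinOrder t})
    (hdiv : ∀ n : ℕ, n ≠ 0 → Function.Surjective fun t : T => t ^ n) :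
    IsDomain (KRing T PUnit) := by
  -- Characters with equal n-th powers agree on all n-th powers of elements, which by divisibility
  -- is the whole group.
  have : IsMulTorsionFree (T →ₜ* ℂˣ) := ⟨fun n hn χ ψ h => by
    ext t
    obtain ⟨s, rfl⟩ := hdiv n hn t
    simpa using congrArg Units.val (DFunLike.congr_fun h s)⟩
  have := uniqueProds_of_isMulTorsionFree (T →ₜ* ℂˣ)
  have hinj : Function.Injective (MonoidAlgebra.lift ℤ (KRing T PUnit) (T →ₜ* ℂˣ) (charClass T)) :=
    fun a b h => charHom_lift_injective (congrArg (charHom T) h)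
  have e := RingEquiv.ofBijective (MonoidAlgebra.lift ℤ (KRing T PUnit) (T →ₜ* ℂˣ) (charClass T))
    ⟨hinj, charClass_lift_surjective hT⟩
  exact MulEquiv.isDomain (MonoidAlgebra ℤ (T →ₜ* ℂˣ)) e.symm.toMulEquiv

end Diagonalizable

/-! ### The maximal torus: divisibility and density of torsion. -/

section Torus

variable (r : ℕ)

theorem mem_ker_torus {r : ℕ} {t : Fin (r + 1) → Circle} :
    t ∈ MonoidHom.ker (∏ j : Fin (r + 1), Pi.evalMonoidHom (fun _ : Fin (r + 1) => Circle) j)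
      ↔ ∏ j, t j = 1 := by
  rw [MonoidHom.mem_ker, MonoidHom.finsetProd_apply]
  rfl

/-- The parametrization of the maximal torus by angles. -/
noncomputable def torusParam (x : Fin (r + 1) → ℝ) : TGroup r :=
  (Circle.exp (2 * Real.pi * x 0),
    ⟨Fin.cons (Circle.exp (-(2 * Real.pi * ∑ i : Fin r, x i.succ)))
      fun i => Circle.exp (2 * Real.pi * x i.succ), by
      have h : ∏ i : Fin r, Circle.exp (2 * Real.pi * x i.succ)
          = Circle.exp (2 * Real.pi * ∑ i : Fin r, x i.succ) := by
        rw [Finset.mul_sum]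
        exact (map_sum Circle.expHom _ Finset.univ).symm
      rw [mem_ker_torus, Fin.prod_univ_succ]
      simp [h]⟩)

theorem torusParam_nsmul (n : ℕ) (x : Fin (r + 1) → ℝ) :
    torusParam r (n • x) = torusParam r x ^ n := by
  refine Prod.ext ?_ (Subtype.ext (funext fun j => ?_))
  · simp only [torusParam, Prod.pow_fst, ← Circle.exp_nsmul]
    simp [mul_left_comm]
  · refine Fin.cases ?_ (fun i => ?_) j
    · simp only [torusParam, Prod.pow_snd, SubmonoidClass.coe_pow, Pi.pow_apply, Fin.cons_zero,
        ← Circle.exp_nsmul]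
      simp [mul_left_comm, Finset.mul_sum]
    · simp only [torusParam, Prod.pow_snd, SubmonoidClass.coe_pow, Pi.pow_apply, Fin.cons_succ,
        ← Circle.exp_nsmul]
      simp [mul_left_comm]

theorem torusParam_surjective : Function.Surjective (torusParam r) := by
  rintro ⟨s, t, ht⟩
  have hex (z : Circle) : ∃ x : ℝ, Circle.exp (2 * Real.pi * x) = z := by
    obtain ⟨y, rfl⟩ := Circle.exp_surjective z
    exact ⟨y / (2 * Real.pi), by rw [mul_div_cancel₀ _ Real.two_pi_pos.ne']⟩
  choose f hf using hex
  let y : Fin (r + 1) → ℝ := Fin.cons (f s) fun i => f (t i.succ)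
  refine ⟨y, ?_⟩
  have h2 : (torusParam r y).2.1 = t := by
    have hs (i : Fin r) : (torusParam r y).2.1 i.succ = t i.succ := by
      simp [torusParam, y, hf]
    funext j
    refine Fin.cases ?_ hs j
    have h1 := mem_ker_torus.1 (torusParam r y).2.2
    have h2 := mem_ker_torus.1 ht
    rw [Fin.prod_univ_succ] at h1 h2
    rw [Finset.prod_congr rfl fun i _ => hs i, ← h2] at h1
    exact mul_right_cancel h1
  exact Prod.ext (by simp [torusParam, y, hf]) (Subtype.ext h2)

theorem continuous_torusParam : Continuous (torusParam r) := by
  refine Continuous.prodMk (by fun_prop) (Continuous.subtype_mk (continuous_pi fun j => ?_) _)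
  refine Fin.cases ?_ (fun i => ?_) j
  · simp only [Fin.cons_zero]
    fun_prop
  · simp only [Fin.cons_succ]
    fun_prop

/-- Rational angles are dense, and the product of their denominators annihilates the corresponding
point. -/
theorem dense_isOfFinOrder_torus : Dense {t : TGroup r | IsOfFinOrder t} := by
  have h1 : DenseRange (Pi.map fun _ : Fin (r + 1) => ((↑) : ℚ → ℝ)) :=
    DenseRange.piMap fun _ => Rat.denseRange_cast
  refine ((torusParam_surjective r).denseRange.comp h1 (continuous_torusParam r)).mono ?_
  rintro _ ⟨x, rfl⟩
  have hN : 0 < ∏ j, (x j).den := Finset.prod_pos fun j _ => (x j).den_pos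
  refine isOfFinOrder_iff_pow_eq_one.2 ⟨_, hN, ?_⟩
  have hint (j) : ∃ z : ℤ, ((∏ j, (x j).den : ℕ) : ℝ) * (x j : ℝ) = z := by
    obtain ⟨m, hm⟩ := Finset.dvd_prod_of_mem (fun j => (x j).den) (Finset.mem_univ j)
    refine ⟨m * (x j).num, ?_⟩
    have h := Rat.mul_den_eq_num (x j)
    have h' : (x j : ℝ) * ((x j).den : ℝ) = (x j).num := by exact_mod_cast h
    rw [hm]
    push_cast
    rw [← h']
    ring
  choose z hz using hint
  rw [Function.comp_apply, ← torusParam_nsmul]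
  have hx : (∏ j, (x j).den) • Pi.map (fun _ : Fin (r + 1) => ((↑) : ℚ → ℝ)) x
      = fun j => (z j : ℝ) := by
    funext j
    rw [← hz, Pi.smul_apply, nsmul_eq_mul]
    rfl
  rw [hx]
  refine Prod.ext (Circle.exp_two_pi_mul_int _) (Subtype.ext (funext fun j => ?_))
  refine Fin.cases ?_ (fun i => Circle.exp_two_pi_mul_int _) j
  simp only [torusParam, Fin.cons_zero]
  rw [← Int.cast_sum, Circle.exp_neg, Circle.exp_two_pi_mul_int, inv_one]
  rfl

theorem torus_pow_surjective (n : ℕ) (hn : n ≠ 0) :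
    Function.Surjective fun t : TGroup r => t ^ n := by
  intro t
  obtain ⟨x, rfl⟩ := torusParam_surjective r t
  refine ⟨torusParam r ((n : ℝ)⁻¹ • x), ?_⟩
  beta_reduce
  rw [← torusParam_nsmul, ← Nat.cast_smul_eq_nsmul ℝ, smul_smul, mul_inv_cancel₀, one_smul]
  exact_mod_cast hn

instance : IsDomain (RepT r) :=
  isDomain_repRing (dense_isOfFinOrder_torus r) (torus_pow_surjective r)

end Torus

/-! ### Torus weights and tautological lines as splittings of the standard representation. -/

section Weights

variable (r : ℕ)

/-- The standard representation of `S¹ × SU_{r+1}`. -/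
noncomputable def stdRep : GGroup r →* Matrix (Fin (r + 1)) (Fin (r + 1)) ℂ :=
  (Submonoid.subtype _).comp (MonoidHom.snd Circle (SUGroup r))

theorem continuous_stdRep : Continuous (stdRep r) := continuous_subtype_val.comp continuous_snd

theorem continuous_stdRep_torus : Continuous ((stdRep r).comp (torusToG r)) :=
  (continuous_stdRep r).comp (continuous_torusToG r)

variable {r}

theorem stdRep_torusToG (t : TGroup r) :
    stdRep r (torusToG r t) = Matrix.diagonal fun j => (t.2.1 j : ℂ) := rfl

/-- The weight line `j` of the standard representation of the maximal torus. -/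
noncomputable def weightLine (j : Fin (r + 1)) : EqBundle (TGroup r) PUnit (Fin (r + 1)) where
  rep := (stdRep r).comp (torusToG r)
  continuous_rep := continuous_stdRep_torus r
  proj _ := Matrix.diagonal (Pi.single j 1)
  continuous_proj := continuous_const
  idem _ := by
    rw [Matrix.diagonal_mul_diagonal]
    congr 1
    exact (Pi.single_mul j 1 1).symm.trans (by rw [one_mul])
  equivariant t _ := by
    rw [MonoidHom.comp_apply, stdRep_torusToG]
    simp only [Matrix.diagonal_mul_diagonal, mul_comm]

/-- The coordinate `Λ_j` in the representation ring of the maximal torus. -/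
noncomputable def weight (j : Fin (r + 1)) : RepT r := bcls (weightLine j)

theorem charHom_weight (j : Fin (r + 1)) (t : TGroup r) :
    charHom (TGroup r) (weight j) t = t.2.1 j := by
  rw [weight, charHom_bcls, EqBundle.char]
  change Matrix.trace (Matrix.diagonal _ * Matrix.diagonal _) = _
  rw [Matrix.diagonal_mul_diagonal, Matrix.trace_diagonal, Finset.sum_eq_single j]
  · simp
  · intro i _ hi
    simp [hi]
  · simp

/-- Characters detect equality in the representation ring, and at every point of the torus the
coordinates multiply to one. -/
theorem prod_weight : ∏ j : Fin (r + 1), weight j = (1 : RepT r) := by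
  refine charHom_injective (dense_isOfFinOrder_torus r) (funext fun t => ?_)
  rw [map_prod, Finset.prod_apply, map_one, Pi.one_apply]
  simp only [charHom_weight]
  have h := congrArg Circle.coeHom (mem_ker_torus.1 t.2.2)
  rw [map_prod, map_one] at h
  exact h

/-- The coordinate `q` in the representation ring of the maximal torus. -/
noncomputable def qT : (RepT r)ˣ :=
  Units.map (algebraMap (RepG r) (RepT r)).toMonoidHom
    (lineUnit circleChar fun _ => by simp [circleChar, Matrix.rank_one])

theorem charHom_qT (t : TGroup r) : charHom (TGroup r) (qT : (RepT r)ˣ).val t = t.1 := by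
  change charHom _ (kPull _ _ _ _ _ (cls circleChar)) t = _
  rw [← bcls_eq_cls, kPull_bcls, charHom_bcls, EqBundle.char]
  change (Matrix.scalar (Fin 1) (t.1 : ℂ) * 1).trace = _
  simp

theorem algebraMap_extPower_repT (k : ℕ) :
    algebraMap (RepG r) (RepT r) (bcls (extPower PUnit (stdRep r) (continuous_stdRep r) k))
      = ∑ S ∈ Finset.powersetCard k (Finset.univ : Finset (Fin (r + 1))), ∏ j ∈ S, weight j := by
  refine (kPull_bcls _ _ _ _ _ _).trans ?_
  refine Eq.trans ?_ (bcls_extPower (X := PUnit) (continuous_stdRep_torus r) (L := weightLine)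
    (fun _ => rfl) (fun _ => ?_) (fun _ i j hij => ?_) (fun _ j => ?_) k)
  · rfl
  · change ∑ j, Matrix.diagonal (Pi.single j (1 : ℂ)) = 1
    ext a b
    simp [Matrix.sum_apply, Matrix.diagonal_apply, Matrix.one_apply, Pi.single_apply]
  · change Matrix.diagonal _ * Matrix.diagonal _ = 0
    rw [Matrix.diagonal_mul_diagonal', ← Matrix.diagonal_zero]
    congr 1
    funext a
    by_cases h : a = i
    · subst h; simp [hij]
    · simp [h]
  · have h := trace_eq_rank ((weightLine j).idem PUnit.unit)
    have h' : ((weightLine j).proj PUnit.unit).trace = 1 := by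
      simp [weightLine, Matrix.trace_diagonal]
    rw [h'] at h
    exact_mod_cast h.symm

theorem flag_mul_flag (F : Flag r) {i j : Fin (r + 2)} (h : i ≤ j) :
    F.1 j * F.1 i = F.1 i ∧ F.1 i * F.1 j = F.1 i := by
  have h3 := F.2.2.2 i j h
  refine ⟨h3, ?_⟩
  have := congrArg Matrix.conjTranspose h3
  rwa [Matrix.conjTranspose_mul, (F.2.1 _).eq, (F.2.1 _).eq] at this

theorem tautLine_orthogonal (F : Flag r) {i j : Fin (r + 1)} (h : i ≠ j) :
    (tautLine i).proj F * (tautLine j).proj F = 0 := by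
  change (F.1 i.succ - F.1 i.castSucc) * (F.1 j.succ - F.1 j.castSucc) = 0
  rcases lt_or_gt_of_ne h with h | h
  · have h1 : i.succ ≤ j.castSucc := Fin.succ_le_castSucc_iff.2 h
    have h2 := Fin.castSucc_lt_succ (i := i) |>.le
    have h3 := Fin.castSucc_lt_succ (i := j) |>.le
    rw [sub_mul, mul_sub, mul_sub, (flag_mul_flag F h1).2, (flag_mul_flag F (h1.trans h3)).2,
      (flag_mul_flag F (h2.trans h1)).2, (flag_mul_flag F ((h2.trans h1).trans h3)).2]
    simp
  · have h1 : j.succ ≤ i.castSucc := Fin.succ_le_castSucc_iff.2 h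
    have h2 := Fin.castSucc_lt_succ (i := i) |>.le
    have h3 := Fin.castSucc_lt_succ (i := j) |>.le
    rw [sub_mul, mul_sub, mul_sub, (flag_mul_flag F h1).1, (flag_mul_flag F (h1.trans h2)).1,
      (flag_mul_flag F (h3.trans h1)).1, (flag_mul_flag F ((h3.trans h1).trans h2)).1]
    simp

theorem sum_tautLine (F : Flag r) : ∑ j : Fin (r + 1), (tautLine j).proj F = 1 := by
  -- The sum telescopes; its ends are E^0 = 0 and E^{r+1} = ℂ^{r+1}, both forced by the rank
  -- conditions.
  have h0 : F.1 0 = 0 := eq_zero_of_rank_eq_zero (F.2.2.1 0)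
  have h1 : F.1 (Fin.last (r + 1)) = 1 := by
    have hid := F.2.2.2 (Fin.last (r + 1)) _ le_rfl
    have hid' : (1 - F.1 (Fin.last (r + 1))) * (1 - F.1 (Fin.last (r + 1)))
        = 1 - F.1 (Fin.last (r + 1)) := by
      rw [sub_mul, mul_sub, mul_sub, hid]; simp
    have h := trace_eq_rank hid'
    rw [Matrix.trace_sub, trace_eq_rank hid, F.2.2.1, Matrix.trace_one] at h
    simp only [Fintype.card_fin, Fin.val_last, sub_self] at h
    exact (sub_eq_zero.1 (eq_zero_of_rank_eq_zero (by exact_mod_cast h.symm))).symm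
  have key (n : ℕ) (π : Fin (n + 1) → Matrix (Fin (r + 1)) (Fin (r + 1)) ℂ) :
      ∑ j : Fin n, (π j.succ - π j.castSucc) = π (Fin.last n) - π 0 := by
    induction n with
    | zero => simp
    | succ n ih =>
      rw [Fin.sum_univ_castSucc]
      have := ih fun j => π j.castSucc
      simp only [Fin.succ_castSucc, Fin.castSucc_zero] at this ⊢
      rw [this, Fin.succ_last]
      abel
  exact (key (r + 1) F.1).trans (by rw [h0, h1, sub_zero])

/-- Pulled back to the flag manifold, ℂ^{r+1} is equivariantly the orthogonal sum of the
tautological lines, so `bcls_extPower` applies. -/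
theorem algebraMap_extPower_flag (k : ℕ) :
    algebraMap (RepG r) (KFlag r) (bcls (extPower PUnit (stdRep r) (continuous_stdRep r) k))
      = ∑ S ∈ Finset.powersetCard k (Finset.univ : Finset (Fin (r + 1))),
        ∏ j ∈ S, cls (tautLine j) := by
  refine (kPull_bcls _ _ _ _ _ _).trans ?_
  have h := bcls_extPower (X := Flag r) (continuous_stdRep r) (L := tautLine)
    (fun _ => rfl) sum_tautLine (fun F i j hij => tautLine_orthogonal F hij)
    (fun F j => tautLine_rank j F) k
  simp only [bcls_eq_cls] at h
  exact h

end Weights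

/-! ### Relations in K_G(X) ⊗ ℚ(Λ, q) and invertibility of differences of eigenvalues. -/

section Localized

variable {r : ℕ}

variable (r) in
/-- The scalar extension map from the representation ring of the torus to `K_G(X) ⊗ ℚ(Λ, q)`. -/
noncomputable def repToKLoc : RepT r →+* KLoc r :=
  (algebraMap (Scalars r) (KLoc r)).comp (algebraMap (RepT r) (Scalars r))

theorem repToKLoc_algebraMap (w : RepG r) :
    repToKLoc r (algebraMap (RepG r) (RepT r) w) = toKLoc r (algebraMap (RepG r) (KFlag r) w) := by
  have h : algebraMap (RepT r) (Scalars r) (algebraMap (RepG r) (RepT r) w)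
      = algebraMap (RepG r) (Scalars r) w := (IsScalarTower.algebraMap_apply _ _ _ w).symm
  rw [repToKLoc, RingHom.comp_apply, h]
  exact Algebra.TensorProduct.tmul_one_eq_one_tmul (R := RepG r) (A := Scalars r) (B := KFlag r) w

/-- The class of a tautological line bundle in `K_G(X) ⊗ ℚ(Λ, q)`. -/
noncomputable def tautUnit (j : Fin (r + 1)) : (KLoc r)ˣ :=
  Units.map (toKLoc r).toMonoidHom (lineUnit (tautLine j) (tautLine_rank j))

/-- Both sides are images of the class of Λ^k ℂ^{r+1} in K_G(pt), and the tensor product over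
K_G(pt) identifies them. -/
theorem esymm_tautUnit (k : ℕ) :
    ∑ S ∈ Finset.powersetCard k (Finset.univ : Finset (Fin (r + 1))),
        ∏ j ∈ S, (tautUnit j : KLoc r)
      = ∑ S ∈ Finset.powersetCard k (Finset.univ : Finset (Fin (r + 1))),
        ∏ j ∈ S, repToKLoc r (weight j) := by
  have h := repToKLoc_algebraMap (r := r) (bcls (extPower PUnit (stdRep r) (continuous_stdRep r) k))
  rw [algebraMap_extPower_repT, algebraMap_extPower_flag] at h
  simp only [map_sum, map_prod] at h
  exact h.symm

theorem sum_tautUnit : ∑ j : Fin (r + 1), (tautUnit j : KLoc r)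
    = repToKLoc r (∑ j : Fin (r + 1), weight j) := by
  have h := esymm_tautUnit (r := r) 1
  simp only [Finset.powersetCard_one, Finset.sum_map] at h
  simpa using h

/-- The top case of `esymm_tautUnit`. It says that p_{r+1} would be 1, which makes the translation
in t_r act by P_r. -/
theorem prod_tautUnit : ∏ j : Fin (r + 1), (tautUnit j : (KLoc r)ˣ) = 1 := by
  have h := esymm_tautUnit (r := r) (Finset.univ : Finset (Fin (r + 1))).card
  rw [Finset.powersetCard_self, Finset.sum_singleton, Finset.sum_singleton, ← map_prod,
    prod_weight, map_one] at h
  ext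
  simpa using h

theorem prod_sub_eq_of_esymm_eq {R J : Type*} [CommRing R] (s : Finset J) {u v : J → R}
    (h : ∀ k, ∑ S ∈ Finset.powersetCard k s, ∏ j ∈ S, u j
      = ∑ S ∈ Finset.powersetCard k s, ∏ j ∈ S, v j) (x : R) :
    ∏ j ∈ s, (x - u j) = ∏ j ∈ s, (x - v j) := by
  classical
  have key (w : J → R) : ∏ j ∈ s, (x - w j) = ∑ k ∈ Finset.range (s.card + 1),
      (∑ S ∈ Finset.powersetCard k s, ∏ j ∈ S, w j) * ((-1) ^ k * x ^ (s.card - k)) := by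
    simp only [sub_eq_neg_add, Finset.prod_add]
    rw [Finset.sum_powerset]
    refine Finset.sum_congr rfl fun k _ => ?_
    rw [Finset.sum_mul]
    refine Finset.sum_congr rfl fun S hS => ?_
    obtain ⟨h1, h2⟩ := Finset.mem_powersetCard.1 hS
    rw [Finset.prod_const, Finset.card_sdiff_of_subset h1, h2, Finset.prod_neg, h2]
    ring
  rw [key, key]
  simp only [h]

theorem prod_tautUnit_sub_weight (i : Fin (r + 1)) :
    ∏ j : Fin (r + 1), ((tautUnit i : KLoc r) - repToKLoc r (weight j)) = 0 := by
  rw [← prod_sub_eq_of_esymm_eq _ esymm_tautUnit]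
  exact Finset.prod_eq_zero (Finset.mem_univ i) (sub_self _)

theorem map_repToKLoc_qT : Units.map (repToKLoc r).toMonoidHom qT = (q : (KLoc r)ˣ) :=
  Units.ext (repToKLoc_algebraMap (cls circleChar))

/-- The characters Λ_i q^n are pairwise distinct, hence independent. All coefficients are +1, so
coincidences among the f(j) cannot cancel: a nonzero a_j would leave a character on the left that is
absent on the right. -/
theorem sum_weight_mul_qT_injective {f : Fin (r + 1) → Fin (r + 1)} {a : Fin (r + 1) → ℤ}
    (h : ∑ j, weight (f j) * ((qT ^ a j : (RepT r)ˣ) : RepT r) = ∑ j, weight j) : a = 0 := by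
  let χ : Fin (r + 1) × ℤ → TGroup r →* ℂ := fun x => Circle.coeHom.comp
    (((Pi.evalMonoidHom (fun _ => Circle) x.1).comp
      ((Subgroup.subtype _).comp (MonoidHom.snd _ _))) * (MonoidHom.fst _ _) ^ x.2)
  have hχ (x t) : χ x t = (t.2.1 x.1 : ℂ) * ((t.1 ^ x.2 : Circle) : ℂ) := rfl
  have hinj : Function.Injective χ := by
    rintro ⟨i, m⟩ ⟨j, n⟩ h
    -- Powers of q are separated at Λ = 1 and q = exp(πi/(m−n)), where q^{m−n} = −1.
    have hmn : m = n := by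
      by_contra hmn
      have hk : ((m - n : ℤ) : ℝ) ≠ 0 := by exact_mod_cast sub_ne_zero.2 hmn
      have h1 := DFunLike.congr_fun h (Circle.exp (Real.pi / (m - n : ℤ)), 1)
      simp only [hχ, OneMemClass.coe_one, Pi.one_apply, Circle.coe_one, one_mul] at h1
      have h2 := Circle.ext h1
      rw [← div_eq_one, div_eq_mul_inv, ← zpow_sub, ← Circle.exp_zsmul, zsmul_eq_mul, mul_div_cancel₀ _ hk] at h2
      exact Circle.exp_pi_ne_one h2
    have hij : i = j := by
      by_contra hij
      let z : Circle := Circle.exp (Real.pi / 2)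
      -- The two coordinates are mutually inverse to respect Λ_0⋯Λ_r = 1; with z = √−1 their ratio
      -- is −1.
      let t : Fin (r + 1) → Circle := Pi.mulSingle i z * Pi.mulSingle j z⁻¹
      have ht : ∏ k, t k = 1 := by
        simp only [t, Pi.mul_apply, Finset.prod_mul_distrib, Finset.prod_pi_mulSingle', Finset.mem_univ, if_true, mul_inv_cancel]
      have h1 := DFunLike.congr_fun h (1, ⟨t, mem_ker_torus.2 ht⟩)
      simp only [hχ, one_zpow, Circle.coe_one, mul_one] at h1
      have h2 : t i = t j := Circle.ext h1
      simp only [t, Pi.mul_apply, Pi.mulSingle_eq_same, Pi.mulSingle_eq_of_ne hij,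
        Pi.mulSingle_eq_of_ne (Ne.symm hij), mul_one, one_mul] at h2
      rw [eq_inv_iff_mul_eq_one, ← Circle.exp_add, add_halves] at h2
      exact Circle.exp_pi_ne_one h2
    rw [hij, hmn]
  have hli := (linearIndependent_monoidHom (TGroup r) ℂ).comp χ hinj
  have heq : ∑ j, Finsupp.single (f j, a j) (1 : ℂ) = ∑ j, Finsupp.single (j, (0 : ℤ)) 1 := by
    refine hli ?_
    simp only [map_sum, Finsupp.linearCombination_single, one_smul]
    funext t
    have h1 := congrFun (congrArg (charHom (TGroup r)) h) t
    simp only [map_sum, map_mul, Finset.sum_apply, Pi.mul_apply, charHom_weight] at h1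
    have hq (n : ℤ) : charHom (TGroup r) ((qT ^ n : (RepT r)ˣ) : RepT r) t
        = ((t.1 ^ n : Circle) : ℂ) := by
      let ev : RepT r →* ℂ := ((Pi.evalRingHom (fun _ => ℂ) t).comp (charHom (TGroup r))).toMonoidHom
      have : Units.map ev qT = Circle.toUnits t.1 := Units.ext (charHom_qT t)
      have h2 := congrArg Units.val (congrArg (· ^ n) this)
      simp only [← map_zpow] at h2
      exact h2
    simp only [hq] at h1
    simp only [Finset.sum_apply, Function.comp_apply, hχ]
    rw [h1]
    simp
  by_contra ha
  obtain ⟨j₀, hj₀⟩ := Function.ne_iff.1 ha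
  have h1 := DFunLike.congr_fun heq (f j₀, a j₀)
  simp only [Finsupp.finsetSum_apply, Finsupp.single_apply] at h1
  rw [Finset.sum_boole, Finset.sum_eq_zero] at h1
  · have h2 := Finset.card_eq_zero.1 (Nat.cast_eq_zero.1 h1)
    exact Finset.notMem_empty j₀ (h2 ▸ Finset.mem_filter.2 ⟨Finset.mem_univ _, rfl⟩)
  · intro j _
    refine if_neg fun h => hj₀ ?_
    exact (Prod.ext_iff.1 h).2.symm

/-- The eigenvalues of the leading coefficients of the Toda operator at different monomials are
disjoint. -/
theorem isUnit_symbol_sub {a : Fin (r + 1) → ℤ} (ha : a ≠ 0) :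
    IsUnit (∑ j, ((tautUnit j * q ^ a j : (KLoc r)ˣ) : KLoc r)
      - repToKLoc r (∑ j : Fin (r + 1), weight j)) := by
  by_contra hu
  obtain ⟨m, hm, hmem⟩ := exists_max_ideal_of_mem_nonunits hu
  let _ := Ideal.Quotient.field m
  let ψ : RepT r →+* KLoc r ⧸ m := (Ideal.Quotient.mk m).comp (repToKLoc r)
  -- ℚ(Λ, q) is a field, because the representation ring is a domain, so it embeds in the residue
  -- field.
  have hψ : Function.Injective ψ :=
    (((Ideal.Quotient.mk m).comp (algebraMap (Scalars r) (KLoc r))).injective).comp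
      (IsFractionRing.injective (RepT r) (Scalars r))
  -- In the residue field the relation ∏_k (P_i − Λ_k) = 0 has a vanishing factor.
  have hroot (i : Fin (r + 1)) : ∃ k, Ideal.Quotient.mk m (tautUnit i : KLoc r) = ψ (weight k) := by
    have h := congrArg (Ideal.Quotient.mk m) (prod_tautUnit_sub_weight i)
    rw [map_prod, map_zero, Finset.prod_eq_zero_iff] at h
    obtain ⟨k, -, hk⟩ := h
    exact ⟨k, sub_eq_zero.1 ((map_sub _ _ _).symm.trans hk)⟩
  choose f hf using hroot
  refine ha (sum_weight_mul_qT_injective (f := f) (hψ ?_))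
  have hq (n : ℤ) : Ideal.Quotient.mk m ((q ^ n : (KLoc r)ˣ) : KLoc r)
      = ψ ((qT ^ n : (RepT r)ˣ) : RepT r) := by
    rw [← map_repToKLoc_qT, ← map_zpow]
    rfl
  have h := Ideal.Quotient.eq_zero_iff_mem.2 hmem
  rw [map_sub, sub_eq_zero, map_sum] at h
  rw [map_sum]
  refine Eq.trans (Finset.sum_congr rfl fun j _ => ?_) h
  rw [map_mul, ← hf, ← hq, ← map_mul, Units.val_mul]

end Localized

/-! ### The Toda operator on monomials and the uniqueness of its eigenvectors. -/

section Symbol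

variable {r : ℕ}

/-- The hypothesis serves the last index, which is no `castSucc`: the left side is then 1 and the
right side is the full product. -/
theorem prod_ite_castSucc {H : Type*} [CommGroup H] {y : Fin (r + 1) → H} (hy : ∏ j, y j = 1)
    (j : Fin (r + 1)) :
    ∏ i : Fin r, (∏ k with k ≤ i.castSucc, y k) ^ (Pi.single j 1 : Fin (r + 1) → ℤ) i.castSucc
      = ∏ k with k ≤ j, y k := by
  refine Fin.lastCases ?_ (fun i => ?_) j
  · rw [Finset.prod_eq_one fun i _ => ?_]
    · simp [Fin.le_last, hy]
    · rw [Pi.single_eq_of_ne i.castSucc_ne_last, zpow_zero]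
  · rw [Finset.prod_eq_single i]
    · simp
    · intro k _ hk
      rw [Pi.single_eq_of_ne (fun h => hk (Fin.castSucc_injective _ h)), zpow_zero]
    · simp

theorem prod_ite_succ {H : Type*} [CommGroup H] (y : Fin (r + 1) → H) (j : Fin (r + 1)) :
    ∏ i : Fin r, (∏ k with k ≤ i.castSucc, y k) ^ (Pi.single j 1 : Fin (r + 1) → ℤ) i.succ
      = ∏ k with k < j, y k := by
  refine Fin.cases ?_ (fun i => ?_) j
  · rw [Finset.prod_eq_one fun i _ => ?_]
    · simp
    · rw [Pi.single_eq_of_ne i.succ_ne_zero, zpow_zero]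
  · rw [Finset.prod_eq_single i]
    · simp [← Fin.le_castSucc_iff]
    · intro k _ hk
      rw [Pi.single_eq_of_ne (fun h => hk (Fin.succ_injective _ h)), zpow_zero]
    · simp

/-- A quotient of consecutive partial products, as in P_j = p_{j+1}/p_j with the convention p_0 =
p_{r+1} = 1. -/
theorem prod_zpow_single_sub {H : Type*} [CommGroup H] {y : Fin (r + 1) → H}
    (hy : ∏ j, y j = 1) (j : Fin (r + 1)) :
    ∏ i : Fin r, (∏ k with k ≤ i.castSucc, y k) ^
      ((Pi.single j 1 : Fin (r + 1) → ℤ) i.castSucc - (Pi.single j 1 : Fin (r + 1) → ℤ) i.succ) = y j := by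
  simp only [zpow_sub]
  rw [Finset.prod_mul_distrib, Finset.prod_inv_distrib, prod_ite_castSucc hy, prod_ite_succ]
  have : (Finset.univ.filter (· ≤ j)) = insert j (Finset.univ.filter (· < j)) := by
    ext k
    simp [le_iff_eq_or_lt]
  rw [this, Finset.prod_insert (by simp), mul_inv_cancel_right]

/-- The exponent of `q` in the action of `q^{∂/∂t_j}` on `Q^d`. -/
def qExp (d : Fin r →₀ ℕ) (j : Fin (r + 1)) : ℤ :=
  ∑ i : Fin r, (d i : ℤ) * ((Pi.single j 1 : Fin (r + 1) → ℤ) i.castSucc - (Pi.single j 1 : Fin (r + 1) → ℤ) i.succ)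

/-- With indices of d starting at 0, the exponent at j < r is d_j − d_{j−1}, where d_{−1} = 0.
Vanishing therefore propagates upwards from d_0 = 0. -/
theorem eq_zero_of_qExp_eq_zero {d : Fin r →₀ ℕ} (h : qExp d = 0) : d = 0 := by
  suffices H : ∀ (n : ℕ) (i : Fin r), (i : ℕ) = n → d i = 0 from
    Finsupp.ext fun i => H i i rfl
  intro n
  induction n using Nat.strong_induction_on with
  | _ n ih =>
  intro i hi
  have h1 := congrFun h i.castSucc
  rw [qExp, Finset.sum_eq_single i] at h1
  · rw [Pi.single_eq_same, Pi.single_eq_of_ne i.castSucc_lt_succ.ne'] at h1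
    simpa using h1
  · intro k _ hk
    rw [Pi.single_eq_of_ne (fun h => hk (Fin.castSucc_injective _ h))]
    by_cases hki : k.succ = i.castSucc
    · have : (k : ℕ) + 1 = i := by simpa using congrArg Fin.val hki
      rw [ih k (by omega) k rfl]
      simp
    · rw [Pi.single_eq_of_ne hki]
      simp
  · simp

theorem shiftFactor_single (d : Fin r →₀ ℕ) (j : Fin (r + 1)) :
    ∏ i : Fin r, (p i * q ^ d i) ^ ((Pi.single j 1 : Fin (r + 1) → ℤ) i.castSucc
        - (Pi.single j 1 : Fin (r + 1) → ℤ) i.succ)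
      = (tautUnit j * q ^ qExp d j : (KLoc r)ˣ) := by
  simp only [mul_zpow]
  rw [Finset.prod_mul_distrib]
  congr 1
  · exact prod_zpow_single_sub prod_tautUnit j
  · have (s : Finset (Fin r)) (n : Fin r → ℤ) : ∏ i ∈ s, (q : (KLoc r)ˣ) ^ n i
        = q ^ ∑ i ∈ s, n i := by
      induction s using Finset.induction_on with
      | empty => simp
      | insert a s ha ih => rw [Finset.prod_insert ha, Finset.sum_insert ha, zpow_add, ih]
    rw [qExp, ← this]
    refine Finset.prod_congr rfl fun i _ => ?_
    rw [← zpow_natCast, ← zpow_mul]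

/-- The eigenvalue of the constant part of the Toda operator on `Q^d`. -/
noncomputable def symbol (d : Fin r →₀ ℕ) : KLoc r :=
  ∑ j, ((tautUnit j * q ^ qExp d j : (KLoc r)ˣ) : KLoc r)

theorem coeff_shift (m : Fin (r + 1) → ℤ) (d : Fin r →₀ ℕ) (I : TwistedSeries r) :
    MvPowerSeries.coeff d (shift m I)
      = ((∏ i : Fin r, (p i * q ^ d i) ^ (m i.castSucc - m i.succ) : (KLoc r)ˣ) : KLoc r)
        * MvPowerSeries.coeff d I := rfl

/-- Translations are diagonal on monomials, and the hypothesis removes the off-diagonal terms. It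
holds at d = 0, and wherever all coefficients of smaller degree vanish. -/
theorem coeff_toda {d : Fin r →₀ ℕ} {I : TwistedSeries r}
    (h : ∀ i : Fin r, MvPowerSeries.coeff d (MvPowerSeries.X i * I) = 0) :
    MvPowerSeries.coeff d (toda r I) = symbol d * MvPowerSeries.coeff d I := by
  have h1 (i : Fin r) : MvPowerSeries.coeff d (mulPoly (1 - MvPolynomial.X i) I)
      = MvPowerSeries.coeff d I := by
    have : mulPoly (1 - MvPolynomial.X i) I = I - MvPowerSeries.X i * I := by
      have h2 := map_sub (MvPolynomial.coeToMvPowerSeries.ringHom (σ := Fin r) (R := KLoc r)) 1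
        (MvPolynomial.X i)
      simp only [MvPolynomial.coeToMvPowerSeries.ringHom_apply, MvPolynomial.coe_one,
        MvPolynomial.coe_X] at h2
      rw [mulPoly, LinearMap.mulLeft_apply, h2, sub_mul, one_mul]
    rw [this, map_sub, h, sub_zero]
  rw [toda, LinearMap.add_apply, LinearMap.sum_apply, map_add, map_sum]
  simp only [Module.End.mul_apply, coeff_shift, h1, shiftFactor_single]
  rw [symbol, Fin.sum_univ_succ, add_mul, Finset.sum_mul]

theorem symbol_zero : symbol (0 : Fin r →₀ ℕ) = repToKLoc r (∑ j : Fin (r + 1), weight j) := by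
  rw [← sum_tautUnit]
  simp [symbol, qExp]

/-- An eigenvector of the Toda operator whose eigenvalue is that of the constants vanishes as soon
as its constant term does. -/
theorem eq_zero_of_toda_eq {J : TwistedSeries r} (h0 : MvPowerSeries.constantCoeff J = 0)
    (hJ : toda r J = repToKLoc r (∑ j : Fin (r + 1), weight j) • J) : J = 0 := by
  suffices H : ∀ (n : ℕ) (d : Fin r →₀ ℕ), d.degree = n → MvPowerSeries.coeff d J = 0 from
    MvPowerSeries.ext fun d => H _ d rfl
  intro n
  induction n using Nat.strong_induction_on with
  | _ n ih =>
  intro d hd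
  by_cases hd0 : d = 0
  · rw [hd0]
    exact h0
  have h1 := congrArg (MvPowerSeries.coeff d) hJ
  rw [coeff_toda fun i => ?_, MvPowerSeries.coeff_smul] at h1
  · have h2 : (symbol d - repToKLoc r (∑ j : Fin (r + 1), weight j)) * MvPowerSeries.coeff d J
        = 0 := by
      rw [sub_mul, h1, sub_self]
    exact ((isUnit_symbol_sub (mt eq_zero_of_qExp_eq_zero hd0)).mul_right_eq_zero).1 h2
  -- The coefficient of Q_i J at d is that of J in degree one less, hence zero by induction, or is
  -- zero outright when Q_i does not divide Q^d.
  · rw [MvPowerSeries.X, MvPowerSeries.coeff_monomial_mul]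
    split_ifs with hi
    · rw [one_mul]
      refine ih _ ?_ _ rfl
      have h3 := congrArg Finsupp.degree (tsub_add_cancel_of_le hi)
      rw [map_add, Finsupp.degree_single, hd] at h3
      omega
    · rfl

/-- The constant term of the equation is (∑ Λ_j − Λ_H) I_0 = 0. The first factor comes from a field,
so if nonzero it would be invertible and kill I_0. -/
theorem eigenvalue_eq {I : TwistedSeries r} (hI : MvPowerSeries.constantCoeff I ≠ 0)
    {l : Scalars r} (hH : toda r I = algebraMap (Scalars r) (KLoc r) l • I) :
    algebraMap (Scalars r) (KLoc r) l = repToKLoc r (∑ j : Fin (r + 1), weight j) := by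
  have h1 := congrArg (MvPowerSeries.coeff 0) hH
  rw [coeff_toda fun i => MvPowerSeries.coeff_zero_X_mul _ _, MvPowerSeries.coeff_smul,
    symbol_zero, ← sub_eq_zero, ← sub_mul] at h1
  rw [repToKLoc, RingHom.comp_apply] at h1 ⊢
  by_contra hne
  refine hI ?_
  rw [← map_sub] at h1
  have hu : IsUnit (algebraMap (RepT r) (Scalars r) (∑ j, weight j) - l) := by
    refine isUnit_iff_ne_zero.2 fun h => hne ?_
    rw [sub_eq_zero.1 h]
  exact ((hu.map (algebraMap (Scalars r) (KLoc r))).mul_right_eq_zero).1 h1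

end Symbol

end QToda

theorem mainTheorem7 (r : ℕ) (I : QToda.TwistedSeries r)
    (hI : MvPowerSeries.constantCoeff I ≠ 0)
    (ΛH : QToda.Scalars r) (hH : QToda.toda r I = ΛH • I)
    (c : (Fin (r + 1) → ℤ) →₀ MvPolynomial (Fin r) (QToda.KLoc r))
    (hcomm : Commute (QToda.diffOp c) (QToda.toda r))
    (ΛD : QToda.KLoc r)
    (hD : QToda.diffOp c I - ΛD • I ∈
      Ideal.span (Set.range (MvPowerSeries.X : Fin r → QToda.TwistedSeries r))) :
    QToda.diffOp c I = ΛD • I := by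
  have hH' : QToda.toda r I = algebraMap (QToda.Scalars r) (QToda.KLoc r) ΛH • I :=
    hH.trans (algebraMap_smul (QToda.KLoc r) ΛH I).symm
  have hl := QToda.eigenvalue_eq hI hH'
  rw [hl] at hH'
  refine sub_eq_zero.1 (QToda.eq_zero_of_toda_eq ?_ ?_)
  · have hle : Ideal.span (Set.range (MvPowerSeries.X : Fin r → QToda.TwistedSeries r))
        ≤ RingHom.ker (MvPowerSeries.constantCoeff (σ := Fin r) (R := QToda.KLoc r)) := by
      refine Ideal.span_le.2 ?_
      rintro _ ⟨i, rfl⟩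
      exact MvPowerSeries.constantCoeff_X i
    exact hle hD
  -- Commutation makes D̂I an eigenvector with the eigenvalue of I, and K-linearity of Ĥ does the
  -- same for Λ_D I, even when Λ_D is not a scalar.
  · have h := LinearMap.congr_fun hcomm.eq I
    rw [Module.End.mul_apply, Module.End.mul_apply, hH', map_smul] at h
    rw [map_sub, map_smul, ← h, hH', smul_sub, smul_comm ΛD]
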